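/- **Definitions.** In a partially ordered set write $x\ll y$ if for every increasing sequence $(y_n)_n$ that has a supremum with $y\le\sup_n y_n$ there is $k$ with $x\le y_k$. A \emph{Cu-semigroup} is a commutative monoid $S$ with a translation invariant partial order whose smallest element is $0$, such that (O1) every increasing sequence in $S$ has a supremum; (O2) every element is the supremum of a $\ll$-increasing sequence; (O3) $x'\ll x$ and $y'\ll y$ imply $x'+y'\ll x+y$; (O4) $\sup_n(x_n+y_n)=\sup_n x_n+\sup_n y_n$ for increasing sequences $(x_n)_n,(y_n)_n$. An \emph{ideal} of $S$ is a downward hereditary submonoid closed under suprema of increasing sequences; $S$ is \emph{simple} if $\{0\}$ and $S$ are its only ideals. A \emph{scaled Cu-semigroup} $(S,\Sigma)$ is a Cu-semigroup $S$ with a downward hereditary subset $\Sigma\subseteq S$ that is closed under suprema of increasing sequences and generates $S$ as an ideal; it is called simple if $S$ is. A morphism $(S,\Sigma)\to(T,\Theta)$ is a map $S\to T$ that preserves $0$, addition, order, $\ll$ and suprema of increasing sequences and maps $\Sigma$ into $\Theta$; this gives the category $\mathrm{Cu}_{\mathrm{sc}}$. For an ultrafilter $\mathcal U$ on a set $J$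 and a family $(S_j,\Sigma_j)_{j\in J}$ of scaled Cu-semigroups, the \emph{ultraproduct} is the categorical one, $$\prod_{\mathcal U}(S_j,\Sigma_j)=\varinjlim_{F\in\mathcal U}\ \prod_{j\in F}(S_j,\Sigma_j),$$ with products and inductive limit taken in $\mathrm{Cu}_{\mathrm{sc}}$, $\mathcal U$ ordered by reversed inclusion, and the connecting morphisms induced by the projections; the ultrapower of $(S,\Sigma)$ is the ultraproduct of the constant family. $S$ satisfies (O6) if whenever $x'\ll x\le y+z$ there are $e,f\in S$ with $e\le x,y$, $f\le x,z$ and $x'\le e+f$. For $n\in\mathbb N$, $(S,\Sigma)$ has property $(C_n)$ if $x\le ny$ for all $x,y\in\Sigma$ with $y\ne 0$. An ultrafilter is \emph{countably incomplete} if it is not closed under countable intersections, and \emph{free} if it contains every cofinite set. **Theorem.** Let $\mathcal U$ be a countably incomplete, free ultrafilter on a set $J$, and let $(S_j,\Sigma_j)_{j\in J}$ be a family of scaled Cu-semigroups that satisfy (O6). Then the ultraproduct $\prod_{\mathcal U}(S_j,\Sigma_j)$ exists, and the following are equivalent: 1. $\prod_{\mathcal U}(S_j,\Sigma_j)$ is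 simple. 2. $\prod_{\mathcal U}(S_j,\Sigma_j)$ has $(C_n)$ for some $n\ge 1$. 3. There exist $n\in\mathbb N$ and $F\in\mathcal U$ such that $(S_j,\Sigma_j)$ has $(C_n)$ for all $j\in F$. In particular, if $(S,\Sigma)$ is a scaled Cu-semigroup satisfying (O6), then the ultrapower $\prod_{\mathcal U}(S,\Sigma)$ is simple if and only if $(S,\Sigma)$ has $(C_n)$ for some $n$. -/

import Mathlib

open CategoryTheory CategoryTheory.Limits

universe u v w

namespace Cuntz

section Order

variable {S : Type u}

/-- Sequential compact containment `x ≪ y`: whenever `(aₙ)` is an increasing sequence whose supremum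
exists and satisfies `y ≤ sup aₙ`, some `aₖ` satisfies `x ≤ aₖ`. -/
def WayBelow [PartialOrder S] (x y : S) : Prop :=
  ∀ (a : ℕ → S) (s : S), Monotone a → IsLUB (Set.range a) s → y ≤ s → ∃ k, x ≤ a k

/-- Closed under passing to suprema of increasing sequences. -/
def SeqSupClosed [PartialOrder S] (A : Set S) : Prop :=
  ∀ (a : ℕ → S) (s : S), Monotone a → (∀ n, a n ∈ A) → IsLUB (Set.range a) s → s ∈ A

/-- Abstract Cuntz semigroups. Positively ordered monoids (commutative monoids with a translation
invariant partial order with smallest element `0`) satisfying the axioms (O1) to (O4). -/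
class IsCuSemigroup (S : Type u) [AddCommMonoid S] [PartialOrder S] : Prop
    extends IsOrderedAddMonoid S where
  zero_le : ∀ x : S, 0 ≤ x
  exists_sup : ∀ a : ℕ → S, Monotone a → ∃ s, IsLUB (Set.range a) s
  exists_wayBelow_seq : ∀ x : S, ∃ a : ℕ → S,
    (∀ n, WayBelow (a n) (a (n + 1))) ∧ IsLUB (Set.range a) x
  wayBelow_add : ∀ x' x y' y : S, WayBelow x' x → WayBelow y' y → WayBelow (x' + y') (x + y)
  sup_add : ∀ (a b : ℕ → S) (s t : S), Monotone a → Monotone b →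
    IsLUB (Set.range a) s → IsLUB (Set.range b) t → IsLUB (Set.range fun n => a n + b n) (s + t)

variable [AddCommMonoid S] [PartialOrder S]

/-- Ideals of a Cu-semigroup: downward hereditary submonoids that are closed under suprema of
increasing sequences. -/
structure IsCuIdeal (I : Set S) : Prop where
  zero_mem : (0 : S) ∈ I
  add_mem : ∀ x ∈ I, ∀ y ∈ I, x + y ∈ I
  lower : IsLowerSet I
  sup_mem : SeqSupClosed I

/-- Scales of a Cu-semigroup. The last field says that the ideal generated by `A` is everything. -/
structure IsScale (A : Set S) : Prop where
  lower : IsLowerSet A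
  sup_mem : SeqSupClosed A
  generates : ∀ I : Set S, IsCuIdeal I → A ⊆ I → I = Set.univ

end Order

/-- Scaled Cu-semigroups `(S, Σ)`. -/
structure ScaledCu : Type (u + 1) where
  carrier : Type u
  [addCommMonoid : AddCommMonoid carrier]
  [partialOrder : PartialOrder carrier]
  [isCuSemigroup : IsCuSemigroup carrier]
  scale : Set carrier
  isScale : IsScale scale

attribute [instance] ScaledCu.addCommMonoid ScaledCu.partialOrder ScaledCu.isCuSemigroup

namespace ScaledCu

/-- Scaled Cu-morphisms: additive, zero- and order-preserving maps that preserve the way-below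
relation and suprema of increasing sequences, and that map the scale into the scale. -/
@[ext]
structure Hom (X Y : ScaledCu.{u}) : Type u where
  toFun : X.carrier → Y.carrier
  map_zero : toFun 0 = 0
  map_add : ∀ x y, toFun (x + y) = toFun x + toFun y
  monotone : Monotone toFun
  map_wayBelow : ∀ x y, WayBelow x y → WayBelow (toFun x) (toFun y)
  map_sup : ∀ (a : ℕ → X.carrier) (s : X.carrier), Monotone a → IsLUB (Set.range a) s →
    IsLUB (Set.range fun n => toFun (a n)) (toFun s)
  map_scale : ∀ x ∈ X.scale, toFun x ∈ Y.scale

/-- The category of scaled Cu-semigroups. -/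
instance : Category.{u} ScaledCu.{u} where
  Hom := Hom
  id X :=
    { toFun := fun x => x
      map_zero := rfl
      map_add := fun _ _ => rfl
      monotone := monotone_id
      map_wayBelow := fun _ _ h => h
      map_sup := fun _ _ _ h => h
      map_scale := fun _ h => h }
  comp f g :=
    { toFun := fun x => g.toFun (f.toFun x)
      map_zero := by rw [f.map_zero, g.map_zero]
      map_add := fun x y => by rw [f.map_add, g.map_add]
      monotone := g.monotone.comp f.monotone
      map_wayBelow := fun x y h => g.map_wayBelow _ _ (f.map_wayBelow x y h)
      map_sup := fun a s ha hs =>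
        g.map_sup _ _ (f.monotone.comp ha) (f.map_sup a s ha hs)
      map_scale := fun x hx => g.map_scale _ (f.map_scale x hx) }

/-- Axiom (O6): if `x' ≪ x ≤ y + z`, then `x' ≤ e + f` for some `e ≤ x, y` and `f ≤ x, z`. -/
def SatisfiesO6 (X : ScaledCu.{u}) : Prop :=
  ∀ x' x y z : X.carrier, WayBelow x' x → x ≤ y + z →
    ∃ e f : X.carrier, e ≤ x ∧ e ≤ y ∧ f ≤ x ∧ f ≤ z ∧ x' ≤ e + f

/-- Property `(C_n)`. -/
def HasC (X : ScaledCu.{u}) (n : ℕ) : Prop :=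
  ∀ x ∈ X.scale, ∀ y ∈ X.scale, y ≠ 0 → x ≤ n • y

/-- Simplicity: there are no ideals besides `{0}` and the whole semigroup. -/
def IsSimple (X : ScaledCu.{u}) : Prop :=
  ∀ I : Set X.carrier, IsCuIdeal I → I = {0} ∨ I = Set.univ

end ScaledCu

section Ultraproduct

variable {C : Type u} [Category.{v} C] {J : Type w}

/-- Given products `∏_{j ∈ F} X j` for all `F` in the ultrafilter `U`, the inductive system formed by
them, indexed over `U` ordered by reversed inclusion. For `G ⊆ F`, the connecting morphism
`∏_{j ∈ F} X j ⟶ ∏_{j ∈ G} X j` is the one induced by the projections. -/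
def ultraDiagram (U : Ultrafilter J) (X : J → C)
    (c : ∀ F : {F : Set J // F ∈ U}, Fan fun j : F.1 => X j.1)
    (hc : ∀ F, IsLimit (c F)) : {F : Set J // F ∈ U}ᵒᵖ ⥤ C where
  obj F := (c F.unop).pt
  map {F G} h := Fan.IsLimit.lift (hc G.unop)
    fun j : G.unop.1 => (c F.unop).proj ⟨j.1, leOfHom h.unop j.2⟩
  map_id F := Fan.IsLimit.hom_ext (hc _) _ _ fun j => by simp [Fan.IsLimit.fac]
  map_comp g h := Fan.IsLimit.hom_ext (hc _) _ _ fun j => by simp [Fan.IsLimit.fac]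

/-- A categorical ultraproduct of the family `X` along `U`: an inductive limit, over `F ∈ U`, of
products `∏_{j ∈ F} X j`. -/
structure CatUltraproduct (U : Ultrafilter J) (X : J → C) where
  prod : ∀ F : {F : Set J // F ∈ U}, Fan fun j : F.1 => X j.1
  isLimit : ∀ F, IsLimit (prod F)
  cocone : Cocone (ultraDiagram U X prod isLimit)
  isColimit : IsColimit cocone

/-- The ultraproduct as an object of the category. -/
def CatUltraproduct.obj {U : Ultrafilter J} {X : J → C} (P : CatUltraproduct U X) : C :=
  P.cocone.pt

end Ultraproduct

end Cuntz

/-! The ultraproduct has a concrete model. Its elements are classes of sequences of families in `∏ⱼ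
Sⱼ` that are `≪`-increasing in each coordinate and whose terms are bounded, uniformly in `j`, by
finite sums of scale elements; `x ≤ y` means that each term of `x` lies below some term of `y` on a
set of the filter. Along a principal filter this `ReducedProduct` is the categorical product
(`isLimitFan`); along `U` it is the inductive limit of the products (`isColimitCocone`). This yields
existence, and every ultraproduct is isomorphic to the model by uniqueness of colimits. Scales may
be empty; such objects are zero and initial. If the scales are empty along `U`, existence is shown
separately and all three conditions hold trivially.

(3) ⇒ (2): compare coordinates (`hasC_of_eventually`). (2) ⇒ (1): (O6) in the factors puts a nonzero
scale element below every nonzero element of the ultraproduct (`exists_mem_scale`), so by `(C_n)` a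
nonzero ideal contains the scale and is everything. (1) ⇒ (3) (`exists_eventually_hasC`): if no
`(C_n)` holds on a set of `U`, countable incompleteness yields `N : J → ℕ`, tending to infinity
along `U`, such that `(C_{N j})` fails for `U`-almost all `j`. Witnesses `xⱼ ≰ N j • yⱼ` assemble to
elements `X' ≪ X` and `Y ≠ 0`, and simplicity would give `X' ≤ n • Y` with a fixed `n`, which is
impossible in coordinates with `n ≤ N j`. -/

namespace Cuntz

/-! ### Compact containment and interpolation in Cu-semigroups. -/

section WayBelow

variable {S : Type u} [PartialOrder S] {x y z : S}

theorem WayBelow.le (h : WayBelow x y) : x ≤ y := by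
  obtain ⟨_, hk⟩ := h (fun _ => y) y monotone_const (by simp) le_rfl
  exact hk

theorem WayBelow.trans_le (h : WayBelow x y) (hyz : y ≤ z) : WayBelow x z :=
  fun a s ha hs hz => h a s ha hs (hyz.trans hz)

theorem WayBelow.trans_ge (h : WayBelow y z) (hxy : x ≤ y) : WayBelow x z := fun a s ha hs hz =>
  let ⟨k, hk⟩ := h a s ha hs hz
  ⟨k, hxy.trans hk⟩

theorem monotone_of_wayBelow {a : ℕ → S} (ha : ∀ n, WayBelow (a n) (a (n + 1))) : Monotone a :=
  monotone_nat_of_le_succ fun n => (ha n).le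

/-- The terms of a rapidly increasing sequence are way below its supremum. -/
theorem wayBelow_of_isLUB {a : ℕ → S} (ha : ∀ n, WayBelow (a n) (a (n + 1))) {s : S}
    (hs : IsLUB (Set.range a) s) (n : ℕ) : WayBelow (a n) s :=
  (ha n).trans_le (hs.1 ⟨n + 1, rfl⟩)

theorem exists_le_of_isLUB_le {a b : ℕ → S}
    (ha : ∀ n, WayBelow (a n) (a (n + 1))) (hb : ∀ n, WayBelow (b n) (b (n + 1)))
    {s t : S} (hs : IsLUB (Set.range a) s) (ht : IsLUB (Set.range b) t) (hst : s ≤ t)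
    (n : ℕ) : ∃ m, a n ≤ b m :=
  wayBelow_of_isLUB ha hs n b t (monotone_of_wayBelow hb) ht hst

end WayBelow

section CuSemigroup

variable {S : Type u} [AddCommMonoid S] [PartialOrder S] [IsCuSemigroup S]

theorem zero_wayBelow (x : S) : WayBelow 0 x := fun _ _ _ _ _ => ⟨0, IsCuSemigroup.zero_le _⟩

theorem eq_zero_of_le_zero {x : S} (h : x ≤ 0) : x = 0 := le_antisymm h (IsCuSemigroup.zero_le x)

theorem WayBelow.exists_between {x y : S} (h : WayBelow x y) :
    ∃ z, WayBelow x z ∧ WayBelow z y := by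
  obtain ⟨a, ha, hs⟩ := IsCuSemigroup.exists_wayBelow_seq y
  obtain ⟨k, hk⟩ := h a y (monotone_of_wayBelow ha) hs le_rfl
  exact ⟨a (k + 1), (ha k).trans_ge hk, wayBelow_of_isLUB ha hs _⟩

/-- A way-below pair can be filled by a rapidly increasing sequence. -/
theorem WayBelow.exists_seq_between {x y : S} (h : WayBelow x y) :
    ∃ a : ℕ → S, (∀ n, WayBelow (a n) (a (n + 1))) ∧ ∀ n, WayBelow x (a n) ∧ WayBelow (a n) y := by
  obtain ⟨z, hxz, hzy⟩ := h.exists_between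
  obtain ⟨a, ha, hs⟩ := IsCuSemigroup.exists_wayBelow_seq z
  obtain ⟨k, hk⟩ := hxz a z (monotone_of_wayBelow ha) hs le_rfl
  refine ⟨fun n => a (k + 1 + n), fun n => ha _, fun n => ⟨?_, ?_⟩⟩
  · exact ((ha k).trans_ge hk).trans_le (monotone_of_wayBelow ha (by omega))
  · exact hzy.trans_ge (hs.1 ⟨_, rfl⟩)

theorem le_of_forall_wayBelow {x y : S} (h : ∀ z, WayBelow z x → z ≤ y) : x ≤ y := by
  obtain ⟨a, ha, hs⟩ := IsCuSemigroup.exists_wayBelow_seq x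
  refine hs.2 ?_
  rintro _ ⟨n, rfl⟩
  exact h _ (wayBelow_of_isLUB ha hs n)

theorem exists_wayBelow_not_le {x y : S} (h : ¬ x ≤ y) : ∃ z, WayBelow z x ∧ ¬ z ≤ y := by
  contrapose! h
  exact le_of_forall_wayBelow h

theorem exists_wayBelow_ne_zero {x : S} (h : x ≠ 0) : ∃ z, WayBelow z x ∧ z ≠ 0 := by
  obtain ⟨z, hz, hz0⟩ := exists_wayBelow_not_le fun h' => h (eq_zero_of_le_zero h')
  exact ⟨z, hz, fun h0 => hz0 h0.le⟩

/-- By (O4), sums of rapid approximations of `y` and `z` increase to `y + z`, so one of them already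
dominates `x`. -/
theorem WayBelow.exists_le_add {x y z : S} (h : WayBelow x (y + z)) :
    ∃ y' z', WayBelow y' y ∧ WayBelow z' z ∧ x ≤ y' + z' := by
  obtain ⟨a, ha, hs⟩ := IsCuSemigroup.exists_wayBelow_seq y
  obtain ⟨b, hb, ht⟩ := IsCuSemigroup.exists_wayBelow_seq z
  have ham := monotone_of_wayBelow ha
  have hbm := monotone_of_wayBelow hb
  obtain ⟨k, hk⟩ := h _ _ (fun i j hij => add_le_add (ham hij) (hbm hij))
    (IsCuSemigroup.sup_add a b y z ham hbm hs ht) le_rfl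
  exact ⟨a k, b k, wayBelow_of_isLUB ha hs k, wayBelow_of_isLUB hb ht k, hk⟩

/-- The closure of a downward hereditary submonoid is an ideal. -/
theorem isCuIdeal_wayBelow_subset {A : Set S} (h0 : (0 : S) ∈ A)
    (hadd : ∀ x ∈ A, ∀ y ∈ A, x + y ∈ A) (hlow : IsLowerSet A) :
    IsCuIdeal {x : S | ∀ z, WayBelow z x → z ∈ A} where
  zero_mem z hz := hlow hz.le h0
  add_mem x hx y hy z hz := by
    obtain ⟨x', y', hx', hy', hle⟩ := hz.exists_le_add
    exact hlow hle (hadd _ (hx _ hx') _ (hy _ hy'))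
  lower x y hyx hx z hz := hx z (hz.trans_le hyx)
  sup_mem a s ha haA hs z hz := by
    obtain ⟨z', hzz', hz's⟩ := hz.exists_between
    obtain ⟨k, hk⟩ := hz's a s ha hs le_rfl
    exact haA k z (hzz'.trans_le hk)

end CuSemigroup

/-! ### Finite sums of scale elements, (O6), `(C_n)` and simplicity. -/

namespace ScaledCu

variable (X : ScaledCu.{u})

/-- Elements dominated by a sum of `k` elements that are zero or in the scale. -/
def scaleSums : ℕ → Set X.carrier
  | 0 => {0}
  | k + 1 => {x | ∃ y ∈ scaleSums k, ∃ z ∈ insert 0 X.scale, x ≤ y + z}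

variable {X}

/-- A rapidly increasing sequence with a given supremum. -/
noncomputable def approx (t : X.carrier) : ℕ → X.carrier :=
  (IsCuSemigroup.exists_wayBelow_seq t).choose

theorem approx_wayBelow (t : X.carrier) (n : ℕ) :
    WayBelow (approx t n) (approx t (n + 1)) :=
  (IsCuSemigroup.exists_wayBelow_seq t).choose_spec.1 n

theorem isLUB_approx (t : X.carrier) :
    IsLUB (Set.range (approx t)) t :=
  (IsCuSemigroup.exists_wayBelow_seq t).choose_spec.2

theorem isLowerSet_insert_scale : IsLowerSet (insert 0 X.scale) := by
  rintro x y hyx (rfl | hx)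
  · exact Or.inl (eq_zero_of_le_zero hyx)
  · exact Or.inr (X.isScale.lower hyx hx)

theorem isLowerSet_scaleSums : ∀ k, IsLowerSet (X.scaleSums k)
  | 0 => fun _ _ hyx hx => eq_zero_of_le_zero (hyx.trans (le_of_eq hx))
  | _ + 1 => fun _ _ hyx ⟨y, hy, z, hz, h⟩ => ⟨y, hy, z, hz, hyx.trans h⟩

theorem scaleSums_mono : Monotone X.scaleSums :=
  monotone_nat_of_le_succ fun _ x hx => ⟨x, hx, 0, Or.inl rfl, by simp⟩

theorem zero_mem_scaleSums (k : ℕ) : (0 : X.carrier) ∈ X.scaleSums k :=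
  scaleSums_mono (Nat.zero_le k) rfl

theorem mem_scaleSums_one {x : X.carrier} (hx : x ∈ X.scale) : x ∈ X.scaleSums 1 :=
  ⟨0, rfl, x, Or.inr hx, by simp⟩

theorem add_mem_scaleSums {x y : X.carrier} {k : ℕ} (hx : x ∈ X.scaleSums k) :
    ∀ {l : ℕ}, y ∈ X.scaleSums l → x + y ∈ X.scaleSums (k + l)
  | 0, hy => by
    simpa [show y = 0 from hy] using hx
  | l + 1, ⟨a, ha, b, hb, hle⟩ =>
    ⟨x + a, add_mem_scaleSums hx ha, b, hb, by rw [add_assoc]; exact add_le_add_right hle x⟩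

/-- The elements all of whose `≪`-predecessors lie in some `scaleSums k` form an ideal containing
the scale, hence everything. -/
theorem exists_mem_scaleSums_of_wayBelow {x y : X.carrier} (h : WayBelow x y) :
    ∃ k, x ∈ X.scaleSums k := by
  have hI : IsCuIdeal {x : X.carrier | ∀ z, WayBelow z x → z ∈ {x | ∃ k, x ∈ X.scaleSums k}} :=
    isCuIdeal_wayBelow_subset ⟨0, rfl⟩
      (fun _ ⟨k, hk⟩ _ ⟨l, hl⟩ => ⟨k + l, add_mem_scaleSums hk hl⟩)
      (fun _ _ hyx ⟨k, hk⟩ => ⟨k, isLowerSet_scaleSums k hyx hk⟩)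
  have huniv := X.isScale.generates _ hI fun s hs z hz =>
    ⟨1, mem_scaleSums_one (X.isScale.lower hz.le hs)⟩
  have hy := Set.mem_univ y
  rw [← huniv] at hy
  exact hy x h

theorem Hom.map_mem_scaleSums {Y : ScaledCu.{u}} (f : Hom X Y) :
    ∀ {k : ℕ} {x : X.carrier}, x ∈ X.scaleSums k → f.toFun x ∈ Y.scaleSums k
  | 0, x, hx => by
    rw [show x = 0 from hx, f.map_zero]
    exact zero_mem_scaleSums 0
  | k + 1, x, ⟨a, ha, b, hb, hle⟩ => by
    refine ⟨f.toFun a, f.map_mem_scaleSums ha, f.toFun b, ?_, ?_⟩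
    · rcases hb with rfl | hb
      · exact Or.inl f.map_zero
      · exact Or.inr (f.map_scale b hb)
    · rw [← f.map_add]
      exact f.monotone hle

/-- Under (O6), nonzero elements that are bounded by the scale dominate nonzero elements of the
scale. -/
theorem SatisfiesO6.exists_mem_scale (hX : X.SatisfiesO6) :
    ∀ {k : ℕ} {x : X.carrier}, x ∈ X.scaleSums k → x ≠ 0 → ∃ y ∈ X.scale, y ≤ x ∧ y ≠ 0
  | 0, _, hx, h0 => absurd hx h0
  | k + 1, x, ⟨a, ha, b, hb, hle⟩, h0 => by
    obtain ⟨x', hx', hx0⟩ := exists_wayBelow_ne_zero h0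
    obtain ⟨e, f, hex, hea, hfx, hfb, hef⟩ := hX x' x a b hx' hle
    -- Since `x' ≠ 0`, one of `e`, `f` is nonzero: a nonzero `f ≤ b` lies in the scale itself, a
    -- nonzero `e ≤ a` is handled by recursion on `k`.
    by_cases he : e = 0
    · have hf : f ≠ 0 := by
        rintro rfl
        rw [he, add_zero] at hef
        exact hx0 (eq_zero_of_le_zero hef)
      rcases isLowerSet_insert_scale hfb hb with h | h
      · exact absurd h hf
      · exact ⟨f, h, hfx, hf⟩
    · obtain ⟨y, hy, hye, hy0⟩ := hX.exists_mem_scale (isLowerSet_scaleSums k hea ha) he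
      exact ⟨y, hy, hye.trans hex, hy0⟩

theorem HasC.mono {m n : ℕ} (hmn : m ≤ n) (h : X.HasC m) : X.HasC n := fun x hx y hy hy0 =>
  (h x hx y hy hy0).trans (nsmul_le_nsmul_left (IsCuSemigroup.zero_le y) hmn)

/-- Property `(C_n)` implies simplicity if the nonzero elements of the scale are coinitial. -/
theorem HasC.isSimple {n : ℕ} (h : X.HasC n)
    (hX : ∀ x : X.carrier, x ≠ 0 → ∃ y ∈ X.scale, y ≤ x ∧ y ≠ 0) : X.IsSimple := by
  intro I hI
  by_cases h0 : ∃ x ∈ I, x ≠ 0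
  · right
    obtain ⟨x, hxI, hx0⟩ := h0
    obtain ⟨y, hy, hyx, hy0⟩ := hX x hx0
    have hyI : ∀ k : ℕ, k • y ∈ I := by
      intro k
      induction k with
      | zero => rw [zero_nsmul]; exact hI.zero_mem
      | succ k ih => rw [succ_nsmul]; exact hI.add_mem _ ih _ (hI.lower hyx hxI)
    exact X.isScale.generates I hI fun z hz => hI.lower (h z hz y hy hy0) (hyI n)
  · left
    push Not at h0
    exact Set.Subset.antisymm h0 (Set.singleton_subset_iff.2 hI.zero_mem)

/-- In a simple Cu-semigroup, every compactly contained element is dominated by multiples of any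
given nonzero element. -/
theorem IsSimple.exists_le_nsmul (h : X.IsSimple) {x x' y : X.carrier} (hy : y ≠ 0)
    (hx : WayBelow x' x) : ∃ n : ℕ, x' ≤ n • y := by
  have hI : IsCuIdeal {x : X.carrier | ∀ z, WayBelow z x → z ∈ {x | ∃ n : ℕ, x ≤ n • y}} :=
    isCuIdeal_wayBelow_subset ⟨0, by simp⟩
      (fun _ ⟨k, hk⟩ _ ⟨l, hl⟩ => ⟨k + l, by rw [add_nsmul]; exact add_le_add hk hl⟩)
      (fun _ _ hba ⟨k, hk⟩ => ⟨k, hba.trans hk⟩)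
  rcases h _ hI with h | h
  · refine absurd ?_ hy
    have : y ∈ ({0} : Set X.carrier) := h ▸ fun z hz => ⟨1, by simpa using hz.le⟩
    exact this
  · have hx' := Set.mem_univ x
    rw [← h] at hx'
    exact hx' _ hx

end ScaledCu

end Cuntz

/-! ### Rapidly increasing sequences and their diagonal suprema. -/

namespace Cuntz

/-- Rapidly increasing sequences in the pointwise product `∏ⱼ Sⱼ` whose terms are uniformly bounded
by finite sums of elements of the scales. -/
structure RapidSeq {J : Type v} (S : J → ScaledCu.{w}) where
  val : ℕ → ∀ j, (S j).carrier
  wayBelow : ∀ n j, WayBelow (val n j) (val (n + 1) j)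
  bounded : ∀ n, ∃ k, ∀ j, val n j ∈ (S j).scaleSums k

namespace RapidSeq

variable {J : Type v} {S : J → ScaledCu.{w}} {𝓕 𝓖 : Filter J}

theorem mono (x : RapidSeq S) {m n : ℕ} (h : m ≤ n) (j : J) : x.val m j ≤ x.val n j :=
  monotone_of_wayBelow (fun n => x.wayBelow n j) h

instance : Zero (RapidSeq S) :=
  ⟨⟨fun _ _ => 0, fun _ _ => zero_wayBelow 0, fun _ => ⟨0, fun _ => rfl⟩⟩⟩

instance : Add (RapidSeq S) :=
  ⟨fun x y => ⟨fun n j => x.val n j + y.val n j,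
    fun n j => IsCuSemigroup.wayBelow_add _ _ _ _ (x.wayBelow n j) (y.wayBelow n j), fun n =>
      let ⟨k, hk⟩ := x.bounded n
      let ⟨l, hl⟩ := y.bounded n
      ⟨k + l, fun j => ScaledCu.add_mem_scaleSums (hk j) (hl j)⟩⟩⟩

@[simp] theorem zero_val (n : ℕ) (j : J) : (0 : RapidSeq S).val n j = 0 := rfl

@[simp] theorem add_val (x y : RapidSeq S) (n : ℕ) (j : J) :
    (x + y).val n j = x.val n j + y.val n j := rfl

/-- The comparison of rapidly increasing sequences along a filter. -/
def Le (𝓕 : Filter J) (x y : RapidSeq S) : Prop :=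
  ∀ n, ∃ m, ∀ᶠ j in 𝓕, x.val n j ≤ y.val m j

theorem Le.refl (x : RapidSeq S) : Le 𝓕 x x := fun n => ⟨n, .of_forall fun _ => le_rfl⟩

theorem Le.trans {x y z : RapidSeq S} (hxy : Le 𝓕 x y) (hyz : Le 𝓕 y z) : Le 𝓕 x z := fun n =>
  let ⟨m, hm⟩ := hxy n
  let ⟨l, hl⟩ := hyz m
  ⟨l, hm.mp (hl.mono fun _ h₂ h₁ => h₁.trans h₂)⟩

theorem Le.anti {x y : RapidSeq S} (h : Le 𝓕 x y) (hle : 𝓖 ≤ 𝓕) : Le 𝓖 x y := fun n =>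
  (h n).imp fun _ hm => hm.filter_mono hle

theorem Le.add {x y x' y' : RapidSeq S} (hx : Le 𝓕 x x') (hy : Le 𝓕 y y') :
    Le 𝓕 (x + y) (x' + y') := fun n => by
  obtain ⟨m, hm⟩ := hx n
  obtain ⟨l, hl⟩ := hy n
  refine ⟨max m l, ?_⟩
  filter_upwards [hm, hl] with j h₁ h₂
  exact add_le_add (h₁.trans (x'.mono (le_max_left _ _) j)) (h₂.trans (y'.mono (le_max_right _ _) j))

theorem Le.of_forall {x y : RapidSeq S} (h : ∀ n j, x.val n j ≤ y.val n j) : Le 𝓕 x y := fun n =>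
  ⟨n, .of_forall fun j => h n j⟩

/-- Pointwise way-below pairs can be filled by a rapidly increasing sequence. -/
theorem exists_between {a b : ∀ j, (S j).carrier} (hab : ∀ j, WayBelow (a j) (b j))
    (hb : ∃ k, ∀ j, b j ∈ (S j).scaleSums k) :
    ∃ x : RapidSeq S, ∀ n j, WayBelow (a j) (x.val n j) ∧ WayBelow (x.val n j) (b j) := by
  choose c hc hac using fun j => (hab j).exists_seq_between
  obtain ⟨k, hk⟩ := hb
  exact ⟨⟨fun n j => c j n, fun n j => hc j n,
    fun n => ⟨k, fun j => ScaledCu.isLowerSet_scaleSums k (hac j n).2.le (hk j)⟩⟩,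
    fun n j => hac j n⟩

/-- A rapidly increasing sequence between the `n`-th and the `(n+1)`-st term of `x`. -/
noncomputable def cut (x : RapidSeq S) (n : ℕ) : RapidSeq S :=
  (exists_between (fun j => x.wayBelow n j) (x.bounded (n + 1))).choose

theorem le_cut (x : RapidSeq S) (n p : ℕ) (j : J) : x.val n j ≤ (x.cut n).val p j :=
  ((exists_between (fun j => x.wayBelow n j) (x.bounded (n + 1))).choose_spec p j).1.le

theorem cut_le (x : RapidSeq S) (n p : ℕ) (j : J) : (x.cut n).val p j ≤ x.val (n + 1) j :=
  ((exists_between (fun j => x.wayBelow n j) (x.bounded (n + 1))).choose_spec p j).2.le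

theorem cut_le_self (x : RapidSeq S) (n : ℕ) : Le 𝓕 (x.cut n) x := fun p =>
  ⟨n + 1, .of_forall fun j => x.cut_le n p j⟩

open Classical in
/-- The indices of the diagonal sequence through `X k` at stage `m k`, which stays
with a fixed `X i` in the coordinates where the diagonal fails to be rapidly increasing. -/
noncomputable def diagonalIndex (X : ℕ → RapidSeq S) (m : ℕ → ℕ) : ℕ → J → ℕ × ℕ
  | 0, _ => (0, m 0)
  | k + 1, j =>
    let p := diagonalIndex X m k j
    if WayBelow ((X p.1).val p.2 j) ((X (k + 1)).val (m (k + 1)) j) then (k + 1, m (k + 1))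
    else (p.1, p.2 + 1)

/-- Uniformity in `j` means that only finitely many terms of finitely many `X i` enter at stage `k`;
this keeps the diagonal bounded by the scales. -/
theorem exists_diagonalIndex_le (X : ℕ → RapidSeq S) (m : ℕ → ℕ) (k : ℕ) :
    ∃ N, ∀ j, (diagonalIndex X m k j).1 ≤ N ∧ (diagonalIndex X m k j).2 ≤ N := by
  induction k with
  | zero => exact ⟨m 0, fun j => ⟨Nat.zero_le _, le_rfl⟩⟩
  | succ k ih =>
    obtain ⟨N, hN⟩ := ih
    refine ⟨N + 1 + (k + 1) + m (k + 1), fun j => ?_⟩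
    have := hN j
    simp only [diagonalIndex]
    split_ifs <;> simp only <;> omega

theorem exists_uniform_bound (X : ℕ → RapidSeq S) (N : ℕ) :
    ∃ K, ∀ i ≤ N, ∀ n ≤ N, ∀ j, (X i).val n j ∈ (S j).scaleSums K := by
  choose b hb using fun i => (X i).bounded N
  refine ⟨∑ i ∈ Finset.range (N + 1), b i, fun i hi n hn j => ?_⟩
  refine ScaledCu.isLowerSet_scaleSums _ ((X i).mono hn j) (ScaledCu.scaleSums_mono ?_ (hb i j))
  exact Finset.single_le_sum (f := b) (fun _ _ => Nat.zero_le _)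
    (Finset.mem_range.2 (Nat.lt_succ_of_le hi))

/-- The diagonal sequence with indices `diagonalIndex`. -/
noncomputable def diagonal (X : ℕ → RapidSeq S) (m : ℕ → ℕ) : RapidSeq S where
  val k j := (X (diagonalIndex X m k j).1).val (diagonalIndex X m k j).2 j
  wayBelow k j := by
    simp only [diagonalIndex]
    split_ifs with h
    · exact h
    · exact (X _).wayBelow _ j
  bounded k := by
    obtain ⟨N, hN⟩ := exists_diagonalIndex_le X m k
    obtain ⟨K, hK⟩ := exists_uniform_bound X N
    exact ⟨K, fun j => hK _ (hN j).1 _ (hN j).2 j⟩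

/-- A `RapidSeq` must be `≪`-increasing in every coordinate, which forces the fallback in
`diagonalIndex`. Stage `k` depends on finitely many conditions, so eventually the fallback has not
been used up to that stage. -/
theorem diagonal_val_eventually {X : ℕ → RapidSeq S} {m : ℕ → ℕ}
    (h : ∀ k, ∀ᶠ j in 𝓕, WayBelow ((X k).val (m k) j) ((X (k + 1)).val (m (k + 1)) j)) (k : ℕ) :
    ∀ᶠ j in 𝓕, (diagonal X m).val k j = (X k).val (m k) j := by
  have : ∀ᶠ j in 𝓕, diagonalIndex X m k j = (k, m k) := by
    induction k with
    | zero => exact .of_forall fun j => rfl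
    | succ k ih =>
      filter_upwards [ih, h k] with j hj hk
      rw [diagonalIndex, hj, if_pos hk]
  filter_upwards [this] with j hj
  simp only [diagonal, hj]

theorem exists_eventually_forall_le {X : ℕ → RapidSeq S} (hX : ∀ i k, i ≤ k → Le 𝓕 (X i) (X k))
    (k p : ℕ) : ∃ q, (∀ᶠ j in 𝓕, WayBelow ((X k).val p j) ((X (k + 1)).val q j)) ∧
      ∀ i ≤ k + 1, ∀ᶠ j in 𝓕, (X i).val (k + 1) j ≤ (X (k + 1)).val q j := by
  have h : ∀ i, ∃ q, i ≤ k + 1 → ∀ᶠ j in 𝓕, (X i).val (k + 1) j ≤ (X (k + 1)).val q j := by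
    intro i
    by_cases hi : i ≤ k + 1
    · obtain ⟨q, hq⟩ := hX i (k + 1) hi (k + 1)
      exact ⟨q, fun _ => hq⟩
    · exact ⟨0, fun h => absurd h hi⟩
  choose q hq using h
  obtain ⟨r, hr⟩ := hX k (k + 1) (Nat.le_succ k) p
  refine ⟨∑ i ∈ Finset.range (k + 2), q i + (r + 1), ?_, fun i hi => ?_⟩
  · filter_upwards [hr] with j hj
    exact (((X (k + 1)).wayBelow r j).trans_ge hj).trans_le ((X (k + 1)).mono (by omega) j)
  · filter_upwards [hq i hi] with j hj
    refine hj.trans ((X (k + 1)).mono (le_trans ?_ (Nat.le_add_right _ _)) j)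
    exact Finset.single_le_sum (f := q) (fun _ _ => Nat.zero_le _)
      (Finset.mem_range.2 (Nat.lt_succ_of_le hi))

/-- Diagonal argument for (O1): the term chosen from `X (k + 1)` dominates term `k + 1` of each `X
i` with `i ≤ k + 1`, so the diagonal absorbs all `X i`; it is least because its terms are eventually
terms of the `X k`. -/
theorem exists_sup {X : ℕ → RapidSeq S} (hX : ∀ i k, i ≤ k → Le 𝓕 (X i) (X k)) :
    ∃ s : RapidSeq S, (∀ k, Le 𝓕 (X k) s) ∧
      ∀ n, ∃ k m, ∀ᶠ j in 𝓕, s.val n j ≤ (X k).val m j := by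
  choose q hq hq' using exists_eventually_forall_le hX
  let m : ℕ → ℕ := fun k => Nat.rec 0 (fun k p => q k p) k
  have hm : ∀ k, m (k + 1) = q k (m k) := fun k => rfl
  have hd := diagonal_val_eventually (X := X) (m := m) fun k => by
    rw [hm]
    exact hq k (m k)
  refine ⟨diagonal X m, fun i n => ⟨max i n + 1, ?_⟩, fun n => ⟨n, m n, ?_⟩⟩
  · filter_upwards [hd (max i n + 1), hq' (max i n) (m (max i n)) i (by omega)] with j h₁ h₂
    rw [h₁, hm]
    exact ((X i).mono (by omega) j).trans h₂
  · exact (hd n).mono fun _ h => h.le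

/-- The supremum of the `j`-th coordinates of a rapidly increasing sequence. -/
noncomputable def sup (x : RapidSeq S) (j : J) : (S j).carrier :=
  (IsCuSemigroup.exists_sup (fun n => x.val n j) fun _ _ h => x.mono h j).choose

theorem isLUB_sup (x : RapidSeq S) (j : J) :
    IsLUB (Set.range fun n => x.val n j) (x.sup j) :=
  (IsCuSemigroup.exists_sup (fun n => x.val n j) fun _ _ h => x.mono h j).choose_spec

theorem le_sup (x : RapidSeq S) (n : ℕ) (j : J) : x.val n j ≤ x.sup j :=
  (x.isLUB_sup j).1 ⟨n, rfl⟩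

theorem sup_le {x : RapidSeq S} {j : J} {t : (S j).carrier}
    (h : ∀ n, x.val n j ≤ t) : x.sup j ≤ t :=
  (x.isLUB_sup j).2 (by
    rintro _ ⟨n, rfl⟩
    exact h n)

theorem Le.sup_le_sup {F : Set J} {x y : RapidSeq S}
    (h : x.Le (.principal F) y) {j : J} (hj : j ∈ F) : x.sup j ≤ y.sup j :=
  sup_le fun n =>
    let ⟨m, hm⟩ := h n
    (hm hj).trans (y.le_sup m j)

end RapidSeq

/-- The reduced product of the Cu-semigroups `Sⱼ` along a filter. -/
def ReducedProduct {J : Type v} (S : J → ScaledCu.{w}) (𝓕 : Filter J) : Type max v w :=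
  Quotient (⟨fun x y => x.Le 𝓕 y ∧ y.Le 𝓕 x, fun x => ⟨.refl x, .refl x⟩, fun h => ⟨h.2, h.1⟩,
    fun h h' => ⟨h.1.trans h'.1, h'.2.trans h.2⟩⟩ : Setoid (RapidSeq S))

/-! ### The Cu-semigroup structure and the scale of reduced products. -/

namespace ReducedProduct

open RapidSeq

variable {J : Type v} {S : J → ScaledCu.{w}} {𝓕 𝓖 : Filter J}

/-- The class of a rapidly increasing sequence. -/
def mk (𝓕 : Filter J) (x : RapidSeq S) : ReducedProduct S 𝓕 := Quotient.mk _ x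

theorem mk_surjective : Function.Surjective (mk (S := S) 𝓕) := Quotient.mk_surjective

theorem exists_eq_mk {ι : Type*} (a : ι → ReducedProduct S 𝓕) :
    ∃ X : ι → RapidSeq S, a = fun k => mk 𝓕 (X k) := by
  choose X hX using fun k => mk_surjective (a k)
  exact ⟨X, funext fun k => (hX k).symm⟩

instance : PartialOrder (ReducedProduct S 𝓕) where
  le := Quotient.lift₂ (fun x y => x.Le 𝓕 y) fun _ _ _ _ h h' =>
    propext ⟨fun H => (h.2.trans H).trans h'.1, fun H => (h.1.trans H).trans h'.2⟩
  le_refl := by rintro ⟨x⟩; exact Le.refl x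
  le_trans := by rintro ⟨x⟩ ⟨y⟩ ⟨z⟩ h h'; exact Le.trans h h'
  le_antisymm := by rintro ⟨x⟩ ⟨y⟩ h h'; exact Quotient.sound ⟨h, h'⟩

theorem mk_le_mk {x y : RapidSeq S} : mk 𝓕 x ≤ mk 𝓕 y ↔ x.Le 𝓕 y := Iff.rfl

theorem mk_eq_mk {x y : RapidSeq S} : mk 𝓕 x = mk 𝓕 y ↔ x.Le 𝓕 y ∧ y.Le 𝓕 x :=
  le_antisymm_iff

theorem mk_congr {x y : RapidSeq S} (h : ∀ n j, x.val n j = y.val n j) : mk 𝓕 x = mk 𝓕 y :=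
  mk_eq_mk.2 ⟨.of_forall fun n j => (h n j).le, .of_forall fun n j => (h n j).ge⟩

instance : Zero (ReducedProduct S 𝓕) := ⟨mk 𝓕 0⟩

instance : Add (ReducedProduct S 𝓕) :=
  ⟨Quotient.map₂ (· + ·) fun _ _ h _ _ h' => ⟨h.1.add h'.1, h.2.add h'.2⟩⟩

theorem mk_zero : mk 𝓕 (0 : RapidSeq S) = 0 := rfl

theorem mk_add (x y : RapidSeq S) : mk 𝓕 (x + y) = mk 𝓕 x + mk 𝓕 y := rfl

instance : AddCommMonoid (ReducedProduct S 𝓕) where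
  add_assoc := by
    rintro ⟨x⟩ ⟨y⟩ ⟨z⟩
    exact mk_congr (x := x + y + z) (y := x + (y + z)) fun n j => by simp [add_assoc]
  zero_add := by
    rintro ⟨x⟩
    exact mk_congr (x := 0 + x) fun n j => by simp
  add_zero := by
    rintro ⟨x⟩
    exact mk_congr (x := x + 0) fun n j => by simp
  add_comm := by
    rintro ⟨x⟩ ⟨y⟩
    exact mk_congr (x := x + y) (y := y + x) fun n j => by simp [add_comm]
  nsmul := nsmulRec

theorem isLUB_mk_of {X : ℕ → RapidSeq S} {s : RapidSeq S} (h₁ : ∀ k, (X k).Le 𝓕 s)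
    (h₂ : ∀ n, ∃ k m, ∀ᶠ j in 𝓕, s.val n j ≤ (X k).val m j) :
    IsLUB (Set.range fun k => mk 𝓕 (X k)) (mk 𝓕 s) := by
  refine ⟨?_, fun t ht => ?_⟩
  · rintro _ ⟨k, rfl⟩
    exact h₁ k
  · obtain ⟨t, rfl⟩ := mk_surjective t
    intro n
    obtain ⟨k, m, hm⟩ := h₂ n
    have hk : (X k).Le 𝓕 t := ht ⟨k, rfl⟩
    obtain ⟨l, hl⟩ := hk m
    exact ⟨l, hm.mp (hl.mono fun _ h h' => h'.trans h)⟩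

/-- Suprema are unique, so every supremum inherits the second condition from the diagonal one. The
criterion passes to finer filters and can be checked termwise. -/
theorem isLUB_mk_iff {X : ℕ → RapidSeq S} (hX : Monotone fun k => mk 𝓕 (X k)) {s : RapidSeq S} :
    IsLUB (Set.range fun k => mk 𝓕 (X k)) (mk 𝓕 s) ↔
      (∀ k, (X k).Le 𝓕 s) ∧ ∀ n, ∃ k m, ∀ᶠ j in 𝓕, s.val n j ≤ (X k).val m j := by
  refine ⟨fun h => ⟨fun k => h.1 ⟨k, rfl⟩, fun n => ?_⟩, fun h => isLUB_mk_of h.1 h.2⟩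
  obtain ⟨t, h₁, h₂⟩ := exists_sup (𝓕 := 𝓕) (X := X) fun i k hik => hX hik
  have hst : s.Le 𝓕 t := mk_le_mk.1 (h.unique (isLUB_mk_of h₁ h₂)).le
  obtain ⟨m, hm⟩ := hst n
  obtain ⟨k, l, hl⟩ := h₂ m
  exact ⟨k, l, hm.mp (hl.mono fun _ h h' => h'.trans h)⟩

theorem wayBelow_mk_of {x y : RapidSeq S} {m : ℕ}
    (h : ∀ n, ∀ᶠ j in 𝓕, x.val n j ≤ y.val m j) : WayBelow (mk 𝓕 x) (mk 𝓕 y) := by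
  intro a s ha hs hys
  obtain ⟨X, rfl⟩ := exists_eq_mk a
  obtain ⟨s, rfl⟩ := mk_surjective s
  obtain ⟨-, h₂⟩ := (isLUB_mk_iff ha).1 hs
  have hys : y.Le 𝓕 s := hys
  obtain ⟨l, hl⟩ := hys m
  obtain ⟨k, p, hp⟩ := h₂ l
  refine ⟨k, fun n => ⟨p, ?_⟩⟩
  filter_upwards [h n, hl, hp] with j h₁ h₂ h₃
  exact (h₁.trans h₂).trans h₃

/-- Term `n + 1` of `x` separates the two cuts. The cuts replace the terms of `x` as elements of the
reduced product that approximate its class. -/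
theorem cut_wayBelow_cut (x : RapidSeq S) (n : ℕ) :
    WayBelow (mk 𝓕 (x.cut n)) (mk 𝓕 (x.cut (n + 1))) :=
  wayBelow_mk_of (m := 0) fun p => .of_forall fun j => (x.cut_le n p j).trans (x.le_cut _ _ j)

theorem isLUB_cut (x : RapidSeq S) :
    IsLUB (Set.range fun n => mk 𝓕 (x.cut n)) (mk 𝓕 x) :=
  isLUB_mk_of (fun n => x.cut_le_self n) fun n => ⟨n, 0, .of_forall fun j => x.le_cut n 0 j⟩

theorem cut_wayBelow (x : RapidSeq S) (n : ℕ) : WayBelow (mk 𝓕 (x.cut n)) (mk 𝓕 x) :=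
  wayBelow_of_isLUB (cut_wayBelow_cut x) (isLUB_cut x) n

theorem exists_le_cut {x : ReducedProduct S 𝓕} {y : RapidSeq S} (h : WayBelow x (mk 𝓕 y)) :
    ∃ n, x ≤ mk 𝓕 (y.cut n) :=
  h _ _ (monotone_of_wayBelow (cut_wayBelow_cut y)) (isLUB_cut y) le_rfl

/-- For the forward direction, `x` lies below some cut of `y`, all of whose terms are below a single
term of `y`. The index `m` is uniform in `n`; the set of the filter need not be. -/
theorem wayBelow_mk_iff {x y : RapidSeq S} :
    WayBelow (mk 𝓕 x) (mk 𝓕 y) ↔ ∃ m, ∀ n, ∀ᶠ j in 𝓕, x.val n j ≤ y.val m j := by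
  refine ⟨fun h => ?_, fun ⟨m, hm⟩ => wayBelow_mk_of hm⟩
  obtain ⟨m, hm⟩ := exists_le_cut h
  refine ⟨m + 1, fun n => ?_⟩
  obtain ⟨p, hp⟩ := mk_le_mk.1 hm n
  exact hp.mono fun j hj => hj.trans (y.cut_le m p j)

instance : IsCuSemigroup (ReducedProduct S 𝓕) where
  add_le_add_left := by
    rintro ⟨x⟩ ⟨y⟩ h ⟨z⟩
    exact Le.add h (Le.refl z)
  zero_le := by
    rintro ⟨x⟩
    exact Le.of_forall (x := 0) fun n j => IsCuSemigroup.zero_le _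
  exists_sup a ha := by
    obtain ⟨X, rfl⟩ := exists_eq_mk a
    obtain ⟨t, h₁, h₂⟩ := RapidSeq.exists_sup (𝓕 := 𝓕) (X := X) fun i k hik => ha hik
    exact ⟨mk 𝓕 t, isLUB_mk_of h₁ h₂⟩
  exists_wayBelow_seq x := by
    obtain ⟨x, rfl⟩ := mk_surjective x
    exact ⟨_, cut_wayBelow_cut x, isLUB_cut x⟩
  wayBelow_add x' x y' y hx hy := by
    obtain ⟨x', rfl⟩ := mk_surjective x'
    obtain ⟨x, rfl⟩ := mk_surjective x
    obtain ⟨y', rfl⟩ := mk_surjective y'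
    obtain ⟨y, rfl⟩ := mk_surjective y
    obtain ⟨m, hm⟩ := wayBelow_mk_iff.1 hx
    obtain ⟨l, hl⟩ := wayBelow_mk_iff.1 hy
    refine wayBelow_mk_of (x := x' + y') (y := x + y) (m := max m l) fun n => ?_
    filter_upwards [hm n, hl n] with j h₁ h₂
    exact add_le_add (h₁.trans (x.mono (le_max_left _ _) j))
      (h₂.trans (y.mono (le_max_right _ _) j))
  sup_add a b s t ha hb hs ht := by
    obtain ⟨X, rfl⟩ := exists_eq_mk a
    obtain ⟨Y, rfl⟩ := exists_eq_mk b
    obtain ⟨s, rfl⟩ := mk_surjective s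
    obtain ⟨t, rfl⟩ := mk_surjective t
    obtain ⟨h₁, h₂⟩ := (isLUB_mk_iff ha).1 hs
    obtain ⟨h₃, h₄⟩ := (isLUB_mk_iff hb).1 ht
    refine isLUB_mk_of (X := fun k => X k + Y k) (s := s + t) (fun k => (h₁ k).add (h₃ k))
      fun n => ?_
    obtain ⟨k, m, hm⟩ := h₂ n
    obtain ⟨l, p, hp⟩ := h₄ n
    obtain ⟨m', hm'⟩ := mk_le_mk.1 (ha (le_max_left k l)) m
    obtain ⟨p', hp'⟩ := mk_le_mk.1 (hb (le_max_right k l)) p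
    refine ⟨max k l, max m' p', ?_⟩
    filter_upwards [hm, hp, hm', hp'] with j h₁ h₂ h₃ h₄
    exact add_le_add ((h₁.trans h₃).trans ((X _).mono (le_max_left _ _) j))
      ((h₂.trans h₄).trans ((Y _).mono (le_max_right _ _) j))

/-- The scale of the reduced product. -/
def scale (S : J → ScaledCu.{w}) (𝓕 : Filter J) : Set (ReducedProduct S 𝓕) :=
  {x | ∃ y : RapidSeq S, mk 𝓕 y = x ∧ ∀ n, ∀ᶠ j in 𝓕, y.val n j ∈ (S j).scale}

theorem mem_scale_of_le {x y : RapidSeq S} (hxy : x.Le 𝓕 y) (hy : mk 𝓕 y ∈ scale S 𝓕) (n : ℕ) :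
    ∀ᶠ j in 𝓕, x.val n j ∈ (S j).scale := by
  obtain ⟨z, hzy, hz⟩ := hy
  obtain ⟨m, hm⟩ := hxy.trans (mk_eq_mk.1 hzy).2 n
  filter_upwards [hm, hz m] with j h₁ h₂
  exact (S j).isScale.lower h₁ h₂

theorem mk_mem_scale_iff {x : RapidSeq S} :
    mk 𝓕 x ∈ scale S 𝓕 ↔ ∀ n, ∀ᶠ j in 𝓕, x.val n j ∈ (S j).scale :=
  ⟨fun h n => mem_scale_of_le (.refl x) h n, fun h => ⟨x, rfl, h⟩⟩

/-- Families way below uniformly bounded families are dominated by elements of any ideal that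
contains the scale. -/
theorem exists_mem_of_wayBelow {I : Set (ReducedProduct S 𝓕)} (hI : IsCuIdeal I) (hS : scale S 𝓕 ⊆ I)
    (hne : ∀ᶠ j in 𝓕, (S j).scale.Nonempty) (k : ℕ) :
    ∀ {a b : ∀ j, (S j).carrier}, (∀ j, WayBelow (a j) (b j)) →
      (∀ j, b j ∈ (S j).scaleSums k) → ∃ x : RapidSeq S, mk 𝓕 x ∈ I ∧ ∀ n j, a j ≤ x.val n j := by
  induction k with
  | zero =>
    intro a b hab hb
    refine ⟨0, hI.zero_mem, fun n j => ?_⟩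
    exact (hab j).le.trans (hb j).le
  | succ k ih =>
    intro a b hab hb
    choose c hc d hd hbcd using hb
    choose c' d' hc' hd' had using fun j => ((hab j).trans_le (hbcd j)).exists_le_add
    obtain ⟨x, hxI, hx⟩ := ih hc' hc
    obtain ⟨y, hy⟩ := exists_between hd' ⟨1, fun j => ⟨0, rfl, d j, hd j, by simp⟩⟩
    have hyI : mk 𝓕 y ∈ I := by
      refine hS (mk_mem_scale_iff.2 fun n => ?_)
      -- A zero value lies in the scale only if that scale is nonempty.
      filter_upwards [hne] with j hj
      have h : y.val n j ∈ insert 0 (S j).scale :=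
        ScaledCu.isLowerSet_insert_scale (hy n j).2.le (hd j)
      rcases h with h | h
      · rw [h]
        exact (S j).isScale.lower (IsCuSemigroup.zero_le _) hj.choose_spec
      · exact h
    exact ⟨x + y, hI.add_mem _ hxI _ hyI,
      fun n j => (had j).trans (add_le_add (hx n j) (hy n j).1.le)⟩

theorem isScale (hne : ∀ᶠ j in 𝓕, (S j).scale.Nonempty) : IsScale (scale S 𝓕) where
  lower x y hyx hx := by
    obtain ⟨x, rfl⟩ := mk_surjective x
    obtain ⟨y, rfl⟩ := mk_surjective y
    exact mk_mem_scale_iff.2 (mem_scale_of_le hyx hx)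
  sup_mem a s ha haS hs := by
    obtain ⟨X, rfl⟩ := exists_eq_mk a
    obtain ⟨s, rfl⟩ := mk_surjective s
    refine mk_mem_scale_iff.2 fun n => ?_
    obtain ⟨k, m, hm⟩ := ((isLUB_mk_iff ha).1 hs).2 n
    filter_upwards [hm, mk_mem_scale_iff.1 (haS k) m] with j h₁ h₂
    exact (S j).isScale.lower h₁ h₂
  generates I hI hS := by
    refine Set.eq_univ_of_forall fun x => ?_
    obtain ⟨x, rfl⟩ := mk_surjective x
    refine hI.sup_mem _ _ (monotone_of_wayBelow (cut_wayBelow_cut x)) (fun n => ?_) (isLUB_cut x)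
    -- The cut lies below term `n + 1`, which is `≪` term `n + 2`; the latter provides the uniform
    -- number of scale summands.
    obtain ⟨k, hk⟩ := x.bounded (n + 2)
    obtain ⟨y, hyI, hy⟩ := exists_mem_of_wayBelow hI hS hne k (fun j => x.wayBelow (n + 1) j) hk
    refine hI.lower (mk_le_mk.2 fun p => ⟨0, .of_forall fun j => ?_⟩) hyI
    exact (x.cut_le n p j).trans (hy 0 j)

/-- The reduced product as a scaled Cu-semigroup. -/
def scaledCu (S : J → ScaledCu.{w}) (𝓕 : Filter J) (hne : ∀ᶠ j in 𝓕, (S j).scale.Nonempty) :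
    ScaledCu.{max v w} where
  carrier := ReducedProduct S 𝓕
  scale := scale S 𝓕
  isScale := isScale hne

end ReducedProduct

end Cuntz

/-! ### Morphisms, transport along isomorphisms, and empty scales. -/

namespace Cuntz

namespace ScaledCu

theorem hom_ext {X Y : ScaledCu.{u}} {f g : X ⟶ Y} (h : ∀ x, Hom.toFun f x = Hom.toFun g x) :
    f = g := Hom.ext (funext h)

theorem comp_toFun {X Y Z : ScaledCu.{u}} (f : X ⟶ Y) (g : Y ⟶ Z) (x : X.carrier) :
    Hom.toFun (f ≫ g) x = Hom.toFun g (Hom.toFun f x) := rfl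

theorem toFun_congr {X Y : ScaledCu.{u}} {f g : X ⟶ Y} (h : f = g) (x : X.carrier) :
    Hom.toFun f x = Hom.toFun g x := by rw [h]

theorem inv_hom_apply {X Y : ScaledCu.{u}} (e : X ≅ Y) (y : Y.carrier) :
    Hom.toFun e.hom (Hom.toFun e.inv y) = y := toFun_congr e.inv_hom_id y

theorem map_nsmul {X Y : ScaledCu.{u}} (f : X ⟶ Y) (n : ℕ) (x : X.carrier) :
    Hom.toFun f (n • x) = n • Hom.toFun f x := by
  induction n with
  | zero => rw [zero_nsmul, zero_nsmul, Hom.map_zero]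
  | succ n ih => rw [succ_nsmul, succ_nsmul, Hom.map_add, ih]

theorem HasC.of_iso {X Y : ScaledCu.{u}} (e : X ≅ Y) {n : ℕ} (h : X.HasC n) : Y.HasC n := by
  intro x hx y hy hy0
  have := Hom.monotone e.hom (h _ (Hom.map_scale e.inv x hx) _ (Hom.map_scale e.inv y hy)
    fun h0 => hy0 (by rw [← inv_hom_apply e y, h0, Hom.map_zero]))
  rwa [map_nsmul, inv_hom_apply, inv_hom_apply] at this

theorem isCuIdeal_preimage {X Y : ScaledCu.{u}} (f : X ⟶ Y) {I : Set Y.carrier}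
    (hI : IsCuIdeal I) : IsCuIdeal (Hom.toFun f ⁻¹' I) where
  zero_mem := by
    rw [Set.mem_preimage, Hom.map_zero]
    exact hI.zero_mem
  add_mem x hx y hy := by
    rw [Set.mem_preimage, Hom.map_add]
    exact hI.add_mem _ hx _ hy
  lower _ _ hyx hx := hI.lower (Hom.monotone f hyx) hx
  sup_mem a s ha haI hs := hI.sup_mem _ _ ((Hom.monotone f).comp ha) haI (Hom.map_sup f a s ha hs)

theorem IsSimple.of_iso {X Y : ScaledCu.{u}} (e : X ≅ Y) (h : X.IsSimple) : Y.IsSimple := by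
  intro I hI
  have hmem : ∀ y, y ∈ I ↔ Hom.toFun e.inv y ∈ Hom.toFun e.hom ⁻¹' I := fun y => by
    rw [Set.mem_preimage, inv_hom_apply]
  rcases h _ (isCuIdeal_preimage e.hom hI) with h | h
  · left
    ext y
    rw [hmem, h, Set.mem_singleton_iff, Set.mem_singleton_iff]
    exact ⟨fun h0 => by rw [← inv_hom_apply e y, h0, Hom.map_zero],
      fun h0 => by rw [h0, Hom.map_zero]⟩
  · right
    ext y
    simp [hmem, h]

/-! ### Objects with empty scale -/

/-- The zero ideal contains the empty scale, which generates everything. -/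
theorem subsingleton_of_scale_eq_empty {X : ScaledCu.{u}} (h : X.scale = ∅) :
    Subsingleton X.carrier := by
  have h0 : IsCuIdeal ({0} : Set X.carrier) :=
    { zero_mem := rfl
      add_mem := by
        rintro _ rfl _ rfl
        exact add_zero 0
      lower := by
        rintro _ _ hyx rfl
        exact eq_zero_of_le_zero hyx
      sup_mem := fun a s _ ha hs => eq_zero_of_le_zero (hs.2 (by
        rintro _ ⟨n, rfl⟩
        exact (ha n).le)) }
  have huniv := X.isScale.generates _ h0 (by simp [h])
  rw [← Set.subsingleton_univ_iff, ← huniv]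
  exact Set.subsingleton_singleton

theorem scale_eq_empty_of_hom {X Y : ScaledCu.{u}} (f : X ⟶ Y) (h : Y.scale = ∅) :
    X.scale = ∅ :=
  Set.eq_empty_of_forall_notMem fun x hx => by
    have := Hom.map_scale f x hx
    rw [h] at this
    exact this

/-- The zero map out of an object with empty scale. -/
def zeroHom {X : ScaledCu.{u}} (h : X.scale = ∅) (Y : ScaledCu.{u}) : X ⟶ Y :=
  ({ toFun := fun _ => 0
     map_zero := rfl
     map_add := fun _ _ => (add_zero 0).symm
     monotone := monotone_const
     map_wayBelow := fun _ _ _ => zero_wayBelow 0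
     map_sup := fun _ _ _ _ => by simp
     map_scale := fun x hx => absurd hx (by simp [h]) } : Hom X Y)

/-- Objects with empty scale are initial. -/
def isInitialOfScaleEqEmpty {X : ScaledCu.{u}} (h : X.scale = ∅) : IsInitial X :=
  IsInitial.ofUniqueHom (fun Y => zeroHom h Y) fun Y f => hom_ext fun x => by
    have := subsingleton_of_scale_eq_empty h
    rw [Subsingleton.elim x 0, Hom.map_zero, Hom.map_zero]

theorem hom_ext_of_scale_eq_empty {X Y : ScaledCu.{u}} (h : X.scale = ∅) (f g : X ⟶ Y) : f = g :=
  (isInitialOfScaleEqEmpty h).hom_ext f g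

end ScaledCu

namespace ReducedProduct

open RapidSeq ScaledCu

/-! ### Transition maps, projections and lifts. -/

section Maps

variable {J : Type v} {S : J → ScaledCu.{max u v}} {𝓕 𝓖 : Filter J}

/-- The transition maps between reduced products. -/
def transition (hle : 𝓖 ≤ 𝓕) (h𝓕 : ∀ᶠ j in 𝓕, (S j).scale.Nonempty)
    (h𝓖 : ∀ᶠ j in 𝓖, (S j).scale.Nonempty) : scaledCu S 𝓕 h𝓕 ⟶ scaledCu S 𝓖 h𝓖 :=
  ({ toFun := Quotient.map id fun _ _ h => ⟨h.1.anti hle, h.2.anti hle⟩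
     map_zero := rfl
     map_add := by
       rintro ⟨x⟩ ⟨y⟩
       rfl
     monotone := by
       rintro ⟨x⟩ ⟨y⟩ h
       exact Le.anti (x := x) (y := y) h hle
     map_wayBelow := by
       rintro ⟨x⟩ ⟨y⟩ h
       obtain ⟨m, hm⟩ := wayBelow_mk_iff.1 h
       exact wayBelow_mk_of fun n => (hm n).filter_mono hle
     map_sup := by
       intro a s ha hs
       obtain ⟨X, rfl⟩ := exists_eq_mk a
       obtain ⟨s, rfl⟩ := mk_surjective s
       obtain ⟨h₁, h₂⟩ := (isLUB_mk_iff ha).1 hs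
       exact isLUB_mk_of (fun k => (h₁ k).anti hle) fun n =>
         let ⟨k, m, hm⟩ := h₂ n
         ⟨k, m, hm.filter_mono hle⟩
     map_scale := by
       rintro _ ⟨x, rfl, hx⟩
       exact ⟨x, rfl, fun n => (hx n).filter_mono hle⟩ } :
    Hom (scaledCu S 𝓕 h𝓕) (scaledCu S 𝓖 h𝓖))

/-- The projections of a product. -/
noncomputable def proj {F : Set J} (hF : ∀ᶠ j in .principal F, (S j).scale.Nonempty) (j : F) :
    scaledCu S (.principal F) hF ⟶ S j :=
  ({ toFun := Quotient.lift (fun x => x.sup j) fun _ _ h =>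
       le_antisymm (h.1.sup_le_sup j.2) (h.2.sup_le_sup j.2)
     map_zero := eq_zero_of_le_zero (RapidSeq.sup_le (x := 0) fun _ => le_rfl)
     map_add := by
       rintro ⟨x⟩ ⟨y⟩
       exact ((x + y).isLUB_sup j).unique (IsCuSemigroup.sup_add _ _ _ _
         (fun _ _ h => x.mono h j) (fun _ _ h => y.mono h j) (x.isLUB_sup j) (y.isLUB_sup j))
     monotone := by
       rintro ⟨x⟩ ⟨y⟩ h
       exact RapidSeq.Le.sup_le_sup h j.2
     map_wayBelow := by
       rintro ⟨x⟩ ⟨y⟩ h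
       obtain ⟨m, hm⟩ := wayBelow_mk_iff.1 h
       exact ((y.wayBelow m j).trans_le (y.le_sup _ j)).trans_ge
         (RapidSeq.sup_le fun n => hm n j.2)
     map_sup := by
       intro a s ha hs
       obtain ⟨X, rfl⟩ := exists_eq_mk a
       obtain ⟨s, rfl⟩ := mk_surjective s
       obtain ⟨h₁, h₂⟩ := (isLUB_mk_iff ha).1 hs
       refine ⟨?_, fun t ht => RapidSeq.sup_le fun n => ?_⟩
       · rintro _ ⟨k, rfl⟩
         exact (h₁ k).sup_le_sup j.2
       · obtain ⟨k, m, hm⟩ := h₂ n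
         exact (hm j.2).trans (((X k).le_sup m j).trans (ht ⟨k, rfl⟩))
     map_scale := by
       rintro _ ⟨x, rfl, hx⟩
       exact (S j).isScale.sup_mem _ _ (fun _ _ h => x.mono h j) (fun n => hx n j.2)
         (x.isLUB_sup j) } :
    Hom (scaledCu S (.principal F) hF) (S j))

theorem transition_proj {F G : Set J} (hle : Filter.principal G ≤ .principal F)
    (hF : ∀ᶠ j in .principal F, (S j).scale.Nonempty)
    (hG : ∀ᶠ j in .principal G, (S j).scale.Nonempty) (j : G) :
    transition hle hF hG ≫ proj hG j = proj hF ⟨j, Filter.principal_mono.1 hle j.2⟩ := by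
  refine hom_ext ?_
  rintro ⟨x⟩
  rfl

open Classical in
/-- The image of a rapidly increasing sequence under a family of morphisms. -/
noncomputable def liftSeq {T : ScaledCu.{max u v}} {F : Set J} (f : ∀ j : F, T ⟶ S j)
    (a : ℕ → T.carrier) (ha : ∀ n, WayBelow (a n) (a (n + 1))) : RapidSeq S where
  val n j := if h : j ∈ F then Hom.toFun (f ⟨j, h⟩) (a n) else 0
  wayBelow n j := by
    split_ifs with h
    · exact Hom.map_wayBelow _ _ _ (ha n)
    · exact zero_wayBelow 0
  bounded n := by
    -- The number of summands is found in `T`, so it serves all `j` at once.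
    obtain ⟨k, hk⟩ := exists_mem_scaleSums_of_wayBelow (ha n)
    refine ⟨k, fun j => ?_⟩
    split_ifs with h
    · exact Hom.map_mem_scaleSums _ hk
    · exact zero_mem_scaleSums k

theorem liftSeq_val {T : ScaledCu.{max u v}} {F : Set J} (f : ∀ j : F, T ⟶ S j)
    (a : ℕ → T.carrier) (ha : ∀ n, WayBelow (a n) (a (n + 1))) (n : ℕ) {j : J} (hj : j ∈ F) :
    (liftSeq f a ha).val n j = Hom.toFun (f ⟨j, hj⟩) (a n) := dif_pos hj

theorem liftSeq_le {T : ScaledCu.{max u v}} {F : Set J} (f : ∀ j : F, T ⟶ S j)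
    {a b : ℕ → T.carrier} (ha : ∀ n, WayBelow (a n) (a (n + 1)))
    (hb : ∀ n, WayBelow (b n) (b (n + 1))) (h : ∀ n, ∃ m, a n ≤ b m) :
    (liftSeq f a ha).Le (.principal F) (liftSeq f b hb) := fun n =>
  let ⟨m, hm⟩ := h n
  ⟨m, fun j hj => by
    rw [Set.mem_ofPred_eq, liftSeq_val f a ha n hj, liftSeq_val f b hb m hj]
    exact Hom.monotone _ hm⟩

/-- The underlying map of the morphism into a product given by a family of morphisms. -/
noncomputable def liftFun {T : ScaledCu.{max u v}} {F : Set J} (f : ∀ j : F, T ⟶ S j)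
    (t : T.carrier) : ReducedProduct S (.principal F) :=
  mk _ (liftSeq f (approx t) (approx_wayBelow t))

theorem liftFun_eq {T : ScaledCu.{max u v}} {F : Set J} (f : ∀ j : F, T ⟶ S j)
    {a : ℕ → T.carrier} (ha : ∀ n, WayBelow (a n) (a (n + 1))) {t : T.carrier}
    (ht : IsLUB (Set.range a) t) : liftFun f t = mk _ (liftSeq f a ha) :=
  mk_eq_mk.2 ⟨liftSeq_le f _ ha (exists_le_of_isLUB_le (approx_wayBelow t) ha (isLUB_approx t) ht
    le_rfl), liftSeq_le f ha _ (exists_le_of_isLUB_le ha (approx_wayBelow t) ht (isLUB_approx t)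
    le_rfl)⟩

theorem liftFun_mono {T : ScaledCu.{max u v}} {F : Set J} (f : ∀ j : F, T ⟶ S j) :
    Monotone (liftFun f) := fun s t hst =>
  liftSeq_le f _ _ (exists_le_of_isLUB_le (approx_wayBelow s) (approx_wayBelow t)
    (isLUB_approx s) (isLUB_approx t) hst)

/-- The morphism into a product given by a family of morphisms. -/
noncomputable def lift {T : ScaledCu.{max u v}} {F : Set J}
    (hF : ∀ᶠ j in .principal F, (S j).scale.Nonempty) (f : ∀ j : F, T ⟶ S j) :
    T ⟶ scaledCu S (.principal F) hF :=
  ({ toFun := liftFun f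
     map_zero := mk_eq_mk.2 ⟨fun n => ⟨0, fun j hj => by
       rw [Set.mem_ofPred_eq, liftSeq_val f _ _ n hj, eq_zero_of_le_zero
         ((isLUB_approx (0 : T.carrier)).1 ⟨n, rfl⟩), Hom.map_zero]
       rfl⟩, .of_forall fun n j => IsCuSemigroup.zero_le _⟩
     map_add := fun s t => by
       have hs := approx_wayBelow s
       have ht := approx_wayBelow t
       rw [liftFun_eq f (fun n => IsCuSemigroup.wayBelow_add _ _ _ _ (hs n) (ht n))
         (IsCuSemigroup.sup_add _ _ _ _ (monotone_of_wayBelow hs) (monotone_of_wayBelow ht)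
           (isLUB_approx s) (isLUB_approx t))]
       refine mk_congr (x := liftSeq f _ _) (y := liftSeq f _ hs + liftSeq f _ ht) fun n j => ?_
       by_cases hj : j ∈ F
       · rw [add_val, liftSeq_val f _ _ n hj, liftSeq_val f _ _ n hj, liftSeq_val f _ _ n hj,
           Hom.map_add]
       · simp [liftSeq, hj]
     monotone := liftFun_mono f
     map_wayBelow := fun s t h => by
       obtain ⟨m, hm⟩ := h _ _ (monotone_of_wayBelow (approx_wayBelow t)) (isLUB_approx t) le_rfl
       refine wayBelow_mk_of (m := m) fun n j hj => ?_
       rw [Set.mem_ofPred_eq, liftSeq_val f _ _ n hj, liftSeq_val f _ _ m hj]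
       exact Hom.monotone _ (((isLUB_approx s).1 ⟨n, rfl⟩).trans hm)
     map_sup := fun a s ha hs => by
       refine isLUB_mk_of (fun k => liftFun_mono f (hs.1 ⟨k, rfl⟩)) fun n => ?_
       -- The extra stage `n + 1` makes term `n` way below `a k`, so that some approximant of `a k`
       -- dominates it.
       obtain ⟨k, hk⟩ := wayBelow_of_isLUB (approx_wayBelow s) (isLUB_approx s) (n + 1) a s ha hs
         le_rfl
       obtain ⟨m, hm⟩ := (approx_wayBelow s n).trans_le hk _ _
         (monotone_of_wayBelow (approx_wayBelow (a k))) (isLUB_approx (a k)) le_rfl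
       refine ⟨k, m, fun j hj => ?_⟩
       rw [Set.mem_ofPred_eq, liftSeq_val f _ _ n hj, liftSeq_val f _ _ m hj]
       exact Hom.monotone _ hm
     map_scale := fun t ht => by
       refine mk_mem_scale_iff.2 fun n j hj => ?_
       rw [Set.mem_ofPred_eq, liftSeq_val f _ _ n hj]
       exact Hom.map_scale _ _ (T.isScale.lower ((isLUB_approx t).1 ⟨n, rfl⟩) ht) } :
    Hom T (scaledCu S (.principal F) hF))

theorem lift_proj {T : ScaledCu.{max u v}} {F : Set J}
    (hF : ∀ᶠ j in .principal F, (S j).scale.Nonempty) (f : ∀ j : F, T ⟶ S j) (j : F) :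
    lift hF f ≫ proj hF j = f j := by
  refine hom_ext fun t => ?_
  refine IsLUB.unique (RapidSeq.isLUB_sup (liftSeq f (approx t) (approx_wayBelow t)) j) ?_
  have := Hom.map_sup (f j) _ _ (monotone_of_wayBelow (approx_wayBelow t)) (isLUB_approx t)
  convert this using 3 with n
  exact liftSeq_val f _ _ n j.2

/-- Equal coordinatewise suprema need not give equal classes, since the indices in `Le` must be
uniform in `j`. Preservation of `≪` supplies the uniformity: `f` of an approximant lies below one
term of `f` of the next one, whose coordinate suprema agree with those of `g` and are bounded by one
term at the following stage. -/
theorem hom_le_hom {T : ScaledCu.{max u v}} {F : Set J}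
    {hF : ∀ᶠ j in .principal F, (S j).scale.Nonempty} {f g : T ⟶ scaledCu S (.principal F) hF}
    (h : ∀ j, f ≫ proj hF j = g ≫ proj hF j) (t : T.carrier) :
    Hom.toFun f t ≤ Hom.toFun g t := by
  refine (Hom.map_sup f _ _ (monotone_of_wayBelow (approx_wayBelow t)) (isLUB_approx t)).2 ?_
  rintro _ ⟨n, rfl⟩
  refine le_trans ?_ (Hom.monotone g ((isLUB_approx t).1 ⟨n + 2, rfl⟩))
  have h₁ := Hom.map_wayBelow f _ _ (approx_wayBelow t n)
  have h₂ := Hom.map_wayBelow g _ _ (approx_wayBelow t (n + 1))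
  have h₃ := fun j => toFun_congr (h j) (approx t (n + 1))
  simp only [comp_toFun] at h₃
  simp only
  generalize Hom.toFun f (approx t n) = x at *
  generalize Hom.toFun f (approx t (n + 1)) = y at *
  generalize Hom.toFun g (approx t (n + 1)) = z at *
  generalize Hom.toFun g (approx t (n + 1 + 1)) = w at *
  obtain ⟨x, rfl⟩ := mk_surjective x
  obtain ⟨y, rfl⟩ := mk_surjective y
  obtain ⟨z, rfl⟩ := mk_surjective z
  obtain ⟨w, rfl⟩ := mk_surjective w
  obtain ⟨m, hm⟩ := wayBelow_mk_iff.1 h₁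
  obtain ⟨l, hl⟩ := wayBelow_mk_iff.1 h₂
  refine fun p => ⟨l, fun j hj => ?_⟩
  have h₄ : y.sup j = z.sup j := h₃ ⟨j, hj⟩
  exact ((hm p hj).trans (y.le_sup m j)).trans
    (h₄.trans_le (RapidSeq.sup_le fun n => hl n hj))

theorem hom_ext_proj {T : ScaledCu.{max u v}} {F : Set J}
    {hF : ∀ᶠ j in .principal F, (S j).scale.Nonempty} {f g : T ⟶ scaledCu S (.principal F) hF}
    (h : ∀ j, f ≫ proj hF j = g ≫ proj hF j) : f = g :=
  hom_ext fun t => le_antisymm (hom_le_hom h t) (hom_le_hom (fun j => (h j).symm) t)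

end Maps

end ReducedProduct

end Cuntz

namespace Cuntz

namespace ReducedProduct

open RapidSeq ScaledCu

/-! ### Products exist. -/

section Limits

variable {J : Type v} {S : J → ScaledCu.{max u v}}

/-- The reduced product along a principal filter is a product. -/
noncomputable def isLimitFan {F : Set J} (hF : ∀ᶠ j in .principal F, (S j).scale.Nonempty) :
    IsLimit (Fan.mk (f := fun j : F => S j) (scaledCu S (.principal F) hF) (proj hF)) :=
  Fan.IsLimit.mk _ (fun s => lift hF s.proj) (fun s j => lift_proj hF s.proj j)
    fun s _ hm => hom_ext_proj fun j => (hm j).trans (lift_proj hF s.proj j).symm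

/-- A product with a factor whose scale is empty is isomorphic to that factor. -/
def isLimitFanOfScaleEqEmpty {F : Set J} (i : F) (hi : (S i).scale = ∅) :
    IsLimit (Fan.mk (f := fun j : F => S j) (S i) fun j => zeroHom hi (S j)) :=
  Fan.IsLimit.mk _ (fun s => s.proj i)
    -- A cone point maps to `S i`, so its scale is empty and it is initial.
    (fun s _ => hom_ext_of_scale_eq_empty (scale_eq_empty_of_hom (s.proj i) hi) _ _)
    fun s _ _ => hom_ext_of_scale_eq_empty (scale_eq_empty_of_hom (s.proj i) hi) _ _

variable (S) in
theorem exists_isLimit_fan (F : Set J) :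
    ∃ c : Fan fun j : F => S j, Nonempty (IsLimit c) := by
  by_cases h : ∀ j ∈ F, (S j).scale.Nonempty
  · exact ⟨_, ⟨isLimitFan (F := F) h⟩⟩
  · push Not at h
    obtain ⟨i, hiF, hi⟩ := h
    exact ⟨_, ⟨isLimitFanOfScaleEqEmpty ⟨i, hiF⟩ hi⟩⟩

end Limits

/-! ### Morphisms out of reduced products. -/

section Desc

variable {J : Type v} {S : J → ScaledCu.{max u v}} {𝓕 : Filter J} {T : ScaledCu.{max u v}}

theorem transition_comp {𝓖 𝓗 : Filter J} (h₁ : 𝓖 ≤ 𝓕) (h₂ : 𝓗 ≤ 𝓖)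
    (h𝓕 : ∀ᶠ j in 𝓕, (S j).scale.Nonempty) (h𝓖 : ∀ᶠ j in 𝓖, (S j).scale.Nonempty)
    (h𝓗 : ∀ᶠ j in 𝓗, (S j).scale.Nonempty) :
    transition h₁ h𝓕 h𝓖 ≫ transition h₂ h𝓖 h𝓗 = transition (h₂.trans h₁) h𝓕 h𝓗 := by
  refine hom_ext ?_
  rintro ⟨x⟩
  rfl

/-- Morphisms out of a reduced product are determined on any larger filter. -/
theorem hom_ext_transition {𝓖 : Filter J} {hle : 𝓖 ≤ 𝓕} {h𝓕 : ∀ᶠ j in 𝓕, (S j).scale.Nonempty}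
    {h𝓖 : ∀ᶠ j in 𝓖, (S j).scale.Nonempty} {f g : scaledCu S 𝓖 h𝓖 ⟶ T}
    (h : transition hle h𝓕 h𝓖 ≫ f = transition hle h𝓕 h𝓖 ≫ g) : f = g := by
  refine hom_ext ?_
  rintro ⟨x⟩
  exact toFun_congr h (mk 𝓕 x)

variable (hne : ∀ᶠ j in 𝓕, (S j).scale.Nonempty)
  (φ : ∀ F ∈ 𝓕, ∀ hF : ∀ᶠ j in .principal F, (S j).scale.Nonempty,
    scaledCu S (.principal F) hF ⟶ T)
  (hφ : ∀ F G hF hG h₁ h₂ (hle : Filter.principal G ≤ .principal F),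
    transition hle h₁ h₂ ≫ φ G hG h₂ = φ F hF h₁)

include hφ in
theorem map_mk_eq {F G : Set J} (hF : F ∈ 𝓕) (hG : G ∈ 𝓕)
    (h₁ : ∀ᶠ j in .principal F, (S j).scale.Nonempty)
    (h₂ : ∀ᶠ j in .principal G, (S j).scale.Nonempty) (x : RapidSeq S) :
    Hom.toFun (φ F hF h₁) (mk _ x) = Hom.toFun (φ G hG h₂) (mk _ x) := by
  have h : ∀ᶠ j in .principal (F ∩ G), (S j).scale.Nonempty := fun j hj => h₁ hj.1
  rw [← hφ F (F ∩ G) hF (Filter.inter_mem hF hG) h₁ h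
      (Filter.principal_mono.2 Set.inter_subset_left),
    ← hφ G (F ∩ G) hG (Filter.inter_mem hF hG) h₂ h
      (Filter.principal_mono.2 Set.inter_subset_right)]
  rfl

include hφ in
-- No single set of `𝓕` need witness `x.Le 𝓕 y`, but one set suffices for each cut of `x`; the
-- morphism preserves the supremum of the cuts.
theorem map_mk_le_of_le {F : Set J} (hF : F ∈ 𝓕)
    (hFne : ∀ᶠ j in .principal F, (S j).scale.Nonempty) {x y : RapidSeq S} (h : x.Le 𝓕 y) :
    Hom.toFun (φ F hF hFne) (mk _ x) ≤ Hom.toFun (φ F hF hFne) (mk _ y) := by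
  refine (Hom.map_sup (φ F hF hFne) _ _ (monotone_of_wayBelow (cut_wayBelow_cut x))
    (isLUB_cut x)).2 ?_
  rintro _ ⟨n, rfl⟩
  obtain ⟨m, hm⟩ := h (n + 1)
  have hG : ∀ᶠ j in .principal (F ∩ {j | x.val (n + 1) j ≤ y.val m j}), (S j).scale.Nonempty :=
    fun j hj => hFne hj.1
  simp only
  rw [map_mk_eq φ hφ hF (Filter.inter_mem hF hm) hFne hG,
    map_mk_eq φ hφ hF (Filter.inter_mem hF hm) hFne hG]
  exact Hom.monotone _ (mk_le_mk.2 fun p => ⟨m, fun j hj => (x.cut_le n p j).trans hj.2⟩)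

/-- The morphism out of a reduced product induced by a compatible family of morphisms. -/
def desc : scaledCu S 𝓕 hne ⟶ T :=
  ({ toFun := Quotient.lift (fun x => Hom.toFun (φ _ hne fun _ h => h) (mk _ x)) fun _ _ h =>
       le_antisymm (map_mk_le_of_le φ hφ _ _ h.1) (map_mk_le_of_le φ hφ _ _ h.2)
     map_zero := Hom.map_zero (φ _ hne fun _ h => h)
     map_add := by
       rintro ⟨x⟩ ⟨y⟩
       exact Hom.map_add (φ _ hne fun _ h => h) (mk _ x) (mk _ y)
     monotone := by
       rintro ⟨x⟩ ⟨y⟩ h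
       exact map_mk_le_of_le φ hφ _ _ h
     map_wayBelow := by
       rintro ⟨x⟩ ⟨y⟩ h
       obtain ⟨n, hn⟩ := exists_le_cut (y := y) h
       exact (Hom.map_wayBelow (φ _ hne fun _ h => h) _ _ (cut_wayBelow y n)).trans_ge
         (map_mk_le_of_le φ hφ _ _ hn)
     map_sup := by
       intro a s ha hs
       obtain ⟨X, rfl⟩ := exists_eq_mk a
       obtain ⟨s, rfl⟩ := mk_surjective s
       refine ⟨?_, fun t ht => ?_⟩
       · rintro _ ⟨k, rfl⟩
         exact map_mk_le_of_le φ hφ _ _ (hs.1 ⟨k, rfl⟩)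
       · refine (Hom.map_sup (φ _ hne fun _ h => h) _ _
           (monotone_of_wayBelow (cut_wayBelow_cut s)) (isLUB_cut s)).2 ?_
         rintro _ ⟨n, rfl⟩
         obtain ⟨k, hk⟩ := cut_wayBelow (𝓕 := 𝓕) s n _ _ ha hs le_rfl
         exact (map_mk_le_of_le φ hφ _ _ hk).trans (ht ⟨k, rfl⟩)
     map_scale := by
       rintro _ ⟨x, rfl, hx⟩
       refine T.isScale.sup_mem _ _ ?_ (fun n => ?_)
         (Hom.map_sup (φ _ hne fun _ h => h) _ _
           (monotone_of_wayBelow (cut_wayBelow_cut x)) (isLUB_cut x))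
       · exact (Hom.monotone _).comp (monotone_of_wayBelow (cut_wayBelow_cut x))
       -- On the set where term `n + 1` lies in the scale, the whole cut does.
       · have hG : ∀ᶠ j in .principal {j | x.val (n + 1) j ∈ (S j).scale},
             (S j).scale.Nonempty := fun j hj => ⟨_, hj⟩
         rw [map_mk_eq φ hφ hne (hx (n + 1)) (fun _ h => h) hG]
         exact Hom.map_scale _ _ (mk_mem_scale_iff.2 fun p j hj =>
           (S j).isScale.lower (x.cut_le n p j) hj) } : Hom (scaledCu S 𝓕 hne) T)

theorem transition_desc {F : Set J} (hF : F ∈ 𝓕)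
    (h : ∀ᶠ j in .principal F, (S j).scale.Nonempty) :
    transition (Filter.le_principal_iff.2 hF) h hne ≫ desc hne φ hφ = φ F hF h := by
  refine hom_ext ?_
  rintro ⟨x⟩
  exact map_mk_eq φ hφ _ _ _ _ x

end Desc

/-! ### The reduced product along an ultrafilter as an inductive limit of arbitrary product cones.
-/

section Colimit

variable {J : Type v} {S : J → ScaledCu.{max u v}} {U : Ultrafilter J}
  (prod : ∀ F : {F : Set J // F ∈ U}, Fan fun j : F.1 => S j.1) (hprod : ∀ F, IsLimit (prod F))

section Nonempty

variable (hne : ∀ᶠ j in U, (S j).scale.Nonempty)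

/-- The connecting morphisms between the products. -/
noncomputable def connecting {F G : {F : Set J // F ∈ U}} (hGF : G.1 ⊆ F.1) :
    (prod F).pt ⟶ (prod G).pt :=
  Fan.IsLimit.lift (hprod G) fun j : G.1 => (prod F).proj ⟨j.1, hGF j.2⟩

theorem connecting_proj {F G : {F : Set J // F ∈ U}} (hGF : G.1 ⊆ F.1) (j : G.1) :
    connecting prod hprod hGF ≫ (prod G).proj j = (prod F).proj ⟨j.1, hGF j.2⟩ :=
  Fan.IsLimit.fac _ _ _

/-- The legs of a cocone over the products. -/
def leg (s : Cocone (ultraDiagram U S prod hprod)) (F : {F : Set J // F ∈ U}) :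
    (prod F).pt ⟶ s.pt := s.ι.app ⟨F⟩

theorem connecting_leg (s : Cocone (ultraDiagram U S prod hprod)) {F G : {F : Set J // F ∈ U}}
    (hGF : G.1 ⊆ F.1) : connecting prod hprod hGF ≫ leg prod hprod s G = leg prod hprod s F :=
  s.w (homOfLE (show G ≤ F from hGF)).op

/-- The comparison of a product over `F` with a reduced product over a smaller set. -/
noncomputable def toPrincipal (F : {F : Set J // F ∈ U}) {G : Set J} (hGF : G ⊆ F.1)
    (hG : ∀ᶠ j in .principal G, (S j).scale.Nonempty) :
    (prod F).pt ⟶ scaledCu S (.principal G) hG :=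
  lift hG fun j => (prod F).proj ⟨j, hGF j.2⟩

theorem toPrincipal_proj (F : {F : Set J // F ∈ U}) {G : Set J} (hGF : G ⊆ F.1)
    (hG : ∀ᶠ j in .principal G, (S j).scale.Nonempty) (j : G) :
    toPrincipal prod F hGF hG ≫ proj hG j = (prod F).proj ⟨j, hGF j.2⟩ :=
  lift_proj hG _ j

theorem connecting_toPrincipal {F G : {F : Set J // F ∈ U}} (hGF : G.1 ⊆ F.1)
    {A B : Set J} (hA : A ⊆ F.1) (hB : B ⊆ G.1) (hBA : B ⊆ A)
    (hAne : ∀ᶠ j in .principal A, (S j).scale.Nonempty)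
    (hBne : ∀ᶠ j in .principal B, (S j).scale.Nonempty) :
    connecting prod hprod hGF ≫ toPrincipal prod G hB hBne =
      toPrincipal prod F hA hAne ≫ transition (Filter.principal_mono.2 hBA) hAne hBne := by
  refine hom_ext_proj fun j => ?_
  rw [Category.assoc, Category.assoc, transition_proj, toPrincipal_proj, toPrincipal_proj,
    connecting_proj]

/-- The comparison of a reduced product along a principal filter with a product over the same
set. -/
noncomputable def fromPrincipal (F : {F : Set J // F ∈ U})
    (hF : ∀ᶠ j in .principal F.1, (S j).scale.Nonempty) :
    scaledCu S (.principal F.1) hF ⟶ (prod F).pt :=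
  Fan.IsLimit.lift (hprod F) (proj hF)

theorem fromPrincipal_proj (F : {F : Set J // F ∈ U})
    (hF : ∀ᶠ j in .principal F.1, (S j).scale.Nonempty) (j : F.1) :
    fromPrincipal prod hprod F hF ≫ (prod F).proj j = proj hF j :=
  Fan.IsLimit.fac _ _ _

theorem transition_fromPrincipal {F G : {F : Set J // F ∈ U}} (hGF : G.1 ⊆ F.1)
    (hF : ∀ᶠ j in .principal F.1, (S j).scale.Nonempty)
    (hG : ∀ᶠ j in .principal G.1, (S j).scale.Nonempty) :
    transition (Filter.principal_mono.2 hGF) hF hG ≫ fromPrincipal prod hprod G hG =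
      fromPrincipal prod hprod F hF ≫ connecting prod hprod hGF := by
  refine Fan.IsLimit.hom_ext (hprod G) _ _ fun j => ?_
  rw [Category.assoc, Category.assoc, fromPrincipal_proj, connecting_proj, fromPrincipal_proj,
    transition_proj]

theorem toPrincipal_fromPrincipal {F G : {F : Set J // F ∈ U}} (hGF : G.1 ⊆ F.1)
    (hG : ∀ᶠ j in .principal G.1, (S j).scale.Nonempty) :
    toPrincipal prod F hGF hG ≫ fromPrincipal prod hprod G hG = connecting prod hprod hGF := by
  refine Fan.IsLimit.hom_ext (hprod G) _ _ fun j => ?_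
  rw [Category.assoc, fromPrincipal_proj, connecting_proj, toPrincipal_proj]

theorem fromPrincipal_toPrincipal (F : {F : Set J // F ∈ U}) {G : Set J} (hGF : G ⊆ F.1)
    (hF : ∀ᶠ j in .principal F.1, (S j).scale.Nonempty)
    (hG : ∀ᶠ j in .principal G, (S j).scale.Nonempty) :
    fromPrincipal prod hprod F hF ≫ toPrincipal prod F hGF hG =
      transition (Filter.principal_mono.2 hGF) hF hG := by
  refine hom_ext_proj fun j => ?_
  rw [Category.assoc, toPrincipal_proj, transition_proj, fromPrincipal_proj]

/-- The canonical morphisms from the products to the reduced product along the ultrafilter. -/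
noncomputable def toReduced (F : {F : Set J // F ∈ U}) : (prod F).pt ⟶ scaledCu S U hne :=
  -- Coordinates with empty scale are discarded, so that the intermediate reduced product carries a
  -- scale.
  toPrincipal prod F (G := F.1 ∩ {j | (S j).scale.Nonempty}) Set.inter_subset_left
      (Filter.eventually_principal.2 fun _ h => h.2) ≫
    transition (Filter.le_principal_iff.2 (Filter.inter_mem F.2 hne)) _ hne

theorem connecting_toReduced {F G : {F : Set J // F ∈ U}} (hGF : G.1 ⊆ F.1) :
    connecting prod hprod hGF ≫ toReduced prod hne G = toReduced prod hne F := by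
  rw [toReduced, toReduced, ← Category.assoc, connecting_toPrincipal prod hprod hGF
    Set.inter_subset_left Set.inter_subset_left (Set.inter_subset_inter_left _ hGF),
    Category.assoc, transition_comp]

/-- The cocone with point the reduced product along the ultrafilter. -/
noncomputable def cocone : Cocone (ultraDiagram U S prod hprod) where
  pt := scaledCu S U hne
  ι :=
    { app := fun F => toReduced prod hne F.unop
      naturality := fun F G h =>
        (connecting_toReduced prod hprod hne (F := F.unop) (G := G.unop) (leOfHom h.unop)).trans
          (Category.comp_id _).symm }

/-- The family of morphisms from reduced products along principal filters given by a cocone. -/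
noncomputable def legPrincipal (s : Cocone (ultraDiagram U S prod hprod)) (F : Set J)
    (hF : F ∈ (U : Filter J)) (h : ∀ᶠ j in .principal F, (S j).scale.Nonempty) :
    scaledCu S (.principal F) h ⟶ s.pt :=
  fromPrincipal prod hprod ⟨F, hF⟩ h ≫ leg prod hprod s ⟨F, hF⟩

theorem transition_legPrincipal (s : Cocone (ultraDiagram U S prod hprod)) (F G : Set J)
    (hF : F ∈ (U : Filter J)) (hG : G ∈ (U : Filter J))
    (h₁ : ∀ᶠ j in .principal F, (S j).scale.Nonempty)
    (h₂ : ∀ᶠ j in .principal G, (S j).scale.Nonempty)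
    (hle : Filter.principal G ≤ .principal F) :
    transition hle h₁ h₂ ≫ legPrincipal prod hprod s G hG h₂ =
      legPrincipal prod hprod s F hF h₁ := by
  have hGF : (⟨G, hG⟩ : {F : Set J // F ∈ U}).1 ⊆ (⟨F, hF⟩ : {F : Set J // F ∈ U}).1 :=
    Filter.principal_mono.1 hle
  rw [legPrincipal, legPrincipal, ← Category.assoc,
    transition_fromPrincipal prod hprod hGF h₁ h₂, Category.assoc, connecting_leg]

theorem toReduced_desc (s : Cocone (ultraDiagram U S prod hprod)) (F : {F : Set J // F ∈ U}) :
    toReduced prod hne F ≫ desc hne (legPrincipal prod hprod s)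
      (transition_legPrincipal prod hprod s) = leg prod hprod s F := by
  let G : {F : Set J // F ∈ U} := ⟨F.1 ∩ {j | (S j).scale.Nonempty}, Filter.inter_mem F.2 hne⟩
  have hGF : G.1 ⊆ F.1 := Set.inter_subset_left
  rw [toReduced, Category.assoc, transition_desc (hF := G.2), legPrincipal, ← Category.assoc,
    toPrincipal_fromPrincipal prod hprod (G := G) hGF, connecting_leg]

theorem fromPrincipal_toReduced (F : {F : Set J // F ∈ U})
    (hF : ∀ᶠ j in .principal F.1, (S j).scale.Nonempty) :
    fromPrincipal prod hprod F hF ≫ toReduced prod hne F =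
      transition (Filter.le_principal_iff.2 F.2) hF hne := by
  rw [toReduced, ← Category.assoc, fromPrincipal_toPrincipal, transition_comp]

theorem eq_desc (s : Cocone (ultraDiagram U S prod hprod)) (f : scaledCu S U hne ⟶ s.pt)
    (hf : ∀ F, toReduced prod hne F ≫ f = leg prod hprod s F) :
    f = desc hne (legPrincipal prod hprod s) (transition_legPrincipal prod hprod s) := by
  let F : {F : Set J // F ∈ U} := ⟨{j | (S j).scale.Nonempty}, hne⟩
  have hF : ∀ᶠ j in .principal F.1, (S j).scale.Nonempty :=
    Filter.eventually_principal.2 fun _ h => h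
  refine hom_ext_transition (hle := Filter.le_principal_iff.2 F.2) (h𝓕 := hF) ?_
  rw [transition_desc (hF := F.2), legPrincipal, ← hf, ← Category.assoc, fromPrincipal_toReduced]

/-- The reduced product along an ultrafilter is the inductive limit of the products. -/
noncomputable def isColimitCocone : IsColimit (cocone prod hprod hne) where
  desc s := desc hne (legPrincipal prod hprod s) (transition_legPrincipal prod hprod s)
  fac s F := toReduced_desc prod hprod hne s F.unop
  uniq s f hf := eq_desc prod hprod hne s f fun F => hf ⟨F⟩

end Nonempty

theorem prod_scale_eq_empty (he : ∀ᶠ j in U, (S j).scale = ∅) (F : {F : Set J // F ∈ U}) :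
    (prod F).pt.scale = ∅ := by
  obtain ⟨i, hi, hiF⟩ := (he.and F.2).exists
  exact scale_eq_empty_of_hom ((prod F).proj ⟨i, hiF⟩) hi

/-- If the scales are empty along the ultrafilter, then every object with a morphism from the
products is the point of a unique cocone. -/
def coconeOfScaleEqEmpty (he : ∀ᶠ j in U, (S j).scale = ∅) (X : ScaledCu.{max u v}) :
    Cocone (ultraDiagram U S prod hprod) where
  pt := X
  ι :=
    { app := fun F => zeroHom (prod_scale_eq_empty prod he F.unop) X
      naturality := fun F _ _ =>
        hom_ext_of_scale_eq_empty (prod_scale_eq_empty prod he F.unop) _ _ }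

/-- If the scales are empty along the ultrafilter, then objects with empty scale are inductive
limits of the products. -/
def isColimitCoconeOfScaleEqEmpty (he : ∀ᶠ j in U, (S j).scale = ∅) {X : ScaledCu.{max u v}}
    (hX : X.scale = ∅) : IsColimit (coconeOfScaleEqEmpty prod hprod he X) where
  desc s := zeroHom hX s.pt
  fac _ F := hom_ext_of_scale_eq_empty (prod_scale_eq_empty prod he F.unop) _ _
  uniq _ _ _ := hom_ext_of_scale_eq_empty hX _ _

end Colimit

end ReducedProduct

end Cuntz

namespace Cuntz

namespace ReducedProduct

open RapidSeq ScaledCu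

/-! ### Simplicity and `(C_n)` in the concrete model. -/

section Ultrafilter

variable {J : Type v} {S : J → ScaledCu.{w}} {U : Ultrafilter J}

theorem mk_ne_zero_iff {x : RapidSeq S} :
    mk (U : Filter J) x ≠ 0 ↔ ∃ n, ∀ᶠ j in U, x.val n j ≠ 0 := by
  have h : mk (U : Filter J) x = 0 ↔ ∀ n, ∀ᶠ j in U, x.val n j = 0 := by
    rw [← mk_zero, mk_eq_mk]
    refine ⟨fun h n => ?_, fun h => ⟨fun n => ⟨0, (h n).mono fun j hj => hj.le⟩,
      .of_forall fun n j => IsCuSemigroup.zero_le _⟩⟩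
    obtain ⟨m, hm⟩ := h.1 n
    exact hm.mono fun j hj => eq_zero_of_le_zero hj
  rw [Ne, h, not_forall]
  exact exists_congr fun n => Ultrafilter.eventually_not.symm

/-- In an ultraproduct of Cu-semigroups with (O6), nonzero elements dominate nonzero elements of
the scale. -/
theorem exists_mem_scale (hS : ∀ j, (S j).SatisfiesO6) (x : ReducedProduct S (U : Filter J))
    (hx : x ≠ 0) : ∃ y ∈ scale S (U : Filter J), y ≤ x ∧ y ≠ 0 := by
  obtain ⟨x, rfl⟩ := mk_surjective x
  obtain ⟨n, hn⟩ := mk_ne_zero_iff.1 hx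
  obtain ⟨k, hk⟩ := x.bounded n
  have h : ∀ j, ∃ b a : (S j).carrier, WayBelow a b ∧ b ≤ x.val n j ∧
      (x.val n j ≠ 0 → b ∈ (S j).scale ∧ a ≠ 0) := by
    intro j
    by_cases h0 : x.val n j = 0
    · exact ⟨0, 0, zero_wayBelow 0, IsCuSemigroup.zero_le _, fun h => absurd h0 h⟩
    · obtain ⟨b, hb, hbx, hb0⟩ := (hS j).exists_mem_scale (hk j) h0
      obtain ⟨a, hab, ha⟩ := exists_wayBelow_ne_zero hb0
      exact ⟨b, a, hab, hbx, fun _ => ⟨hb, ha⟩⟩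
  choose b a hab hbx h using h
  obtain ⟨y, hy⟩ := exists_between hab ⟨k, fun j => isLowerSet_scaleSums k (hbx j) (hk j)⟩
  refine ⟨mk _ y, mk_mem_scale_iff.2 fun p => ?_, fun p => ⟨n, ?_⟩, mk_ne_zero_iff.2 ⟨0, ?_⟩⟩
  · filter_upwards [hn] with j hj
    exact (S j).isScale.lower (hy p j).2.le (h j hj).1
  · exact .of_forall fun j => (hy p j).2.le.trans (hbx j)
  · filter_upwards [hn] with j hj h0
    exact (h j hj).2 (eq_zero_of_le_zero ((hy 0 j).1.le.trans h0.le))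

/-- Provides a representative of the multiple whose coordinates are explicit. -/
theorem exists_mk_eq_nsmul (𝓕 : Filter J) (n : ℕ) (x : RapidSeq S) :
    ∃ y : RapidSeq S, mk 𝓕 y = n • mk 𝓕 x ∧ ∀ m j, y.val m j = n • x.val m j := by
  induction n with
  | zero => exact ⟨0, by rw [zero_nsmul, mk_zero], fun m j => by simp⟩
  | succ n ih =>
    obtain ⟨y, hy, hyx⟩ := ih
    exact ⟨y + x, by rw [mk_add, hy, succ_nsmul], fun m j => by rw [add_val, hyx, succ_nsmul]⟩

theorem hasC_of_eventually (hne : ∀ᶠ j in U, (S j).scale.Nonempty) {n : ℕ}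
    (h : ∀ᶠ j in U, (S j).HasC n) : (scaledCu S U hne).HasC n := by
  rintro _ ⟨x, rfl, hx⟩ _ ⟨y, rfl, hy⟩ hy0
  obtain ⟨m, hm⟩ := mk_ne_zero_iff.1 hy0
  obtain ⟨z, hz, hzy⟩ := exists_mk_eq_nsmul (U : Filter J) n y
  have hle : mk (U : Filter J) x ≤ mk (U : Filter J) z := fun p => ⟨m, by
    filter_upwards [h, hx p, hy m, hm] with j h₁ h₂ h₃ h₄
    rw [hzy]
    exact h₁ _ h₂ _ h₃ h₄⟩
  exact hle.trans_eq hz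

theorem exists_eventually_le_of_not_countableInterFilter
    (hU : ¬ CountableInterFilter (U : Filter J)) : ∃ h : J → ℕ, ∀ n, ∀ᶠ j in U, n ≤ h j := by
  classical
  have : ∃ A : ℕ → Set J, (∀ n, A n ∈ U) ∧ ⋂ n, A n ∉ U := by
    by_contra! hA
    refine hU ⟨fun 𝒜 h𝒜 hmem => ?_⟩
    rcases 𝒜.eq_empty_or_nonempty with rfl | hne
    · simp
    · obtain ⟨A, rfl⟩ := h𝒜.exists_eq_range hne
      rw [Set.sInter_range]
      exact hA A fun n => hmem _ ⟨n, rfl⟩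
  obtain ⟨A, hA, hAU⟩ := this
  -- The value is the index of the first `A n` that misses `j`; the default `0` is used only on the
  -- intersection, whose complement lies in `U`.
  refine ⟨fun j => if h : ∃ n, j ∉ A n then Nat.find h else 0, fun n => ?_⟩
  have hn : ∀ᶠ j in U, ∀ i < n, j ∈ A i :=
    (Filter.eventually_all_finite (Set.finite_lt_nat n)).2 fun i _ => hA i
  filter_upwards [hn, Ultrafilter.compl_mem_iff_notMem.2 hAU] with j hj hjA
  have hex : ∃ n, j ∉ A n := by simpa using hjA
  rw [dif_pos hex, Nat.le_find_iff]
  exact fun m hm => not_not.2 (hj m hm)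

/-- Simplicity of an ultraproduct along a countably incomplete ultrafilter forces `(C_n)` with a
uniform constant on the factors. -/
theorem exists_eventually_hasC (hU : ¬ CountableInterFilter (U : Filter J))
    (hne : ∀ᶠ j in U, (S j).scale.Nonempty) (hs : (scaledCu S U hne).IsSimple) :
    ∃ n, ∀ᶠ j in U, (S j).HasC n := by
  classical
  by_contra! hC
  obtain ⟨h, hh⟩ := exists_eventually_le_of_not_countableInterFilter hU
  let N : J → ℕ := fun j => Nat.findGreatest (fun n => ¬ (S j).HasC n) (h j)
  have hN : ∀ᶠ j in U, ¬ (S j).HasC (N j) := by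
    -- Failure of `(C_0)` ensures that `findGreatest` returns an actual failure and not its default
    -- `0`.
    filter_upwards [hC 0] with j hj
    exact Nat.findGreatest_spec (P := fun n => ¬ (S j).HasC n) (Nat.zero_le _) hj
  have hnN : ∀ n, ∀ᶠ j in U, n ≤ N j := by
    intro n
    filter_upwards [hC n, hh n] with j h₁ h₂
    exact Nat.le_findGreatest h₂ h₁
  -- Two interpolations below `x` leave room for `X'` between `x''` and `x'` and for `X` between
  -- `x'` and `x`, so `X' ≪ X`; zeros fill the irrelevant coordinates.
  have hex : ∀ j, ∃ x x' x'' y y' : (S j).carrier, WayBelow x'' x' ∧ WayBelow x' x ∧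
      WayBelow y' y ∧ x ∈ insert 0 (S j).scale ∧ y ∈ insert 0 (S j).scale ∧
      (¬ (S j).HasC (N j) → y ∈ (S j).scale ∧ y' ≠ 0 ∧ ¬ x'' ≤ N j • y) := by
    intro j
    by_cases hj : (S j).HasC (N j)
    · exact ⟨0, 0, 0, 0, 0, zero_wayBelow 0, zero_wayBelow 0, zero_wayBelow 0, Or.inl rfl,
        Or.inl rfl, fun h => absurd hj h⟩
    · have hj' := hj
      unfold HasC at hj'
      push Not at hj'
      obtain ⟨x, hx, y, hy, hy0, hxy⟩ := hj'
      obtain ⟨x'', hx'', hle⟩ := exists_wayBelow_not_le hxy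
      obtain ⟨x', h₁, h₂⟩ := hx''.exists_between
      obtain ⟨y', hy', hy'0⟩ := exists_wayBelow_ne_zero hy0
      exact ⟨x, x', x'', y, y', h₁, h₂, hy', Or.inr hx, Or.inr hy, fun _ => ⟨hy, hy'0, hle⟩⟩
  choose x x' x'' y y' hx'' hx' hy' hx hy hspec using hex
  have hbd : ∀ {b : ∀ j, (S j).carrier}, (∀ j, b j ∈ insert 0 (S j).scale) →
      ∃ k, ∀ j, b j ∈ (S j).scaleSums k := fun hb => ⟨1, fun j => ⟨0, rfl, _, hb j, by simp⟩⟩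
  obtain ⟨X, hX⟩ := exists_between hx' (hbd hx)
  obtain ⟨X', hX'⟩ := exists_between hx''
    (hbd fun j => isLowerSet_insert_scale (hx' j).le (hx j))
  obtain ⟨Y, hY⟩ := exists_between hy' (hbd hy)
  have hXX : WayBelow (mk (U : Filter J) X') (mk (U : Filter J) X) :=
    wayBelow_mk_of (m := 0) fun n => .of_forall fun j => (hX' n j).2.le.trans (hX 0 j).1.le
  have hY0 : mk (U : Filter J) Y ≠ 0 := mk_ne_zero_iff.2 ⟨0, by
    filter_upwards [hN] with j hj h0
    exact (hspec j hj).2.1 (eq_zero_of_le_zero ((hY 0 j).1.le.trans h0.le))⟩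
  obtain ⟨n, hn⟩ := hs.exists_le_nsmul hY0 hXX
  obtain ⟨Z, hZ, hZY⟩ := exists_mk_eq_nsmul (U : Filter J) n Y
  have hle : X'.Le U Z := mk_le_mk.1 (hn.trans_eq hZ.symm)
  obtain ⟨m, hm⟩ := hle 0
  -- One common coordinate suffices: there `x'' ≤ n • y ≤ N j • y`.
  obtain ⟨j, h₁, h₂, h₃⟩ := (hm.and (hN.and (hnN n))).exists
  refine (hspec j h₂).2.2 (((hX' 0 j).1.le.trans h₁).trans ?_)
  rw [hZY]
  exact (nsmul_le_nsmul_right (hY m j).2.le n).trans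
    (nsmul_le_nsmul_left (IsCuSemigroup.zero_le _) h₃)

end Ultrafilter

end ReducedProduct

/-! ### Existence of ultraproducts and the equivalences. -/

open ScaledCu ReducedProduct

theorem eventually_scale_eq_empty_or_nonempty {J : Type v} (U : Ultrafilter J)
    (S : J → ScaledCu.{w}) :
    (∀ᶠ j in U, (S j).scale = ∅) ∨ ∀ᶠ j in U, (S j).scale.Nonempty := by
  rw [← Ultrafilter.eventually_or]
  exact .of_forall fun j => (S j).scale.eq_empty_or_nonempty

theorem nonempty_catUltraproduct {J : Type v} (U : Ultrafilter J) (S : J → ScaledCu.{max u v}) :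
    Nonempty (CatUltraproduct U S) := by
  choose c hc using fun F : {F : Set J // F ∈ U} => exists_isLimit_fan S F.1
  let hprod := fun F => (hc F).some
  rcases eventually_scale_eq_empty_or_nonempty U S with h | h
  · obtain ⟨i, hi⟩ := h.exists
    exact ⟨⟨c, hprod, _, isColimitCoconeOfScaleEqEmpty c hprod h hi⟩⟩
  · exact ⟨⟨c, hprod, _, isColimitCocone c hprod h⟩⟩

/-- Every ultraproduct of scaled Cu-semigroups is a reduced product along the ultrafilter. -/
noncomputable def CatUltraproduct.isoReducedProduct {J : Type v} {U : Ultrafilter J}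
    {S : J → ScaledCu.{max u v}} (P : CatUltraproduct U S)
    (hne : ∀ᶠ j in U, (S j).scale.Nonempty) : P.obj ≅ scaledCu S U hne :=
  P.isColimit.coconePointUniqueUpToIso (isColimitCocone P.prod P.isLimit hne)

/-- The products are initial, so the colimit maps to the factor `S i`, and a morphism into an object
with empty scale has a source with empty scale. -/
theorem CatUltraproduct.scale_eq_empty {J : Type v} {U : Ultrafilter J}
    {S : J → ScaledCu.{max u v}} (P : CatUltraproduct U S) (h : ∀ᶠ j in U, (S j).scale = ∅) :
    P.obj.scale = ∅ := by
  obtain ⟨i, hi⟩ := h.exists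
  exact scale_eq_empty_of_hom
    (P.isColimit.desc (coconeOfScaleEqEmpty P.prod P.isLimit h (S i))) hi

theorem ScaledCu.hasC_of_scale_eq_empty {X : ScaledCu.{u}} (h : X.scale = ∅) (n : ℕ) :
    X.HasC n := fun x hx => absurd hx (by simp [h])

theorem ScaledCu.isSimple_of_scale_eq_empty {X : ScaledCu.{u}} (h : X.scale = ∅) : X.IsSimple :=
  fun I hI => by
    have := subsingleton_of_scale_eq_empty h
    exact Or.inr (Set.eq_univ_of_forall fun x => Subsingleton.elim 0 x ▸ hI.zero_mem)

theorem CatUltraproduct.isSimple_tfae {J : Type v} {U : Ultrafilter J}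
    (hU : ¬ CountableInterFilter (U : Filter J)) {S : J → ScaledCu.{max u v}}
    (hS : ∀ j, (S j).SatisfiesO6) (P : CatUltraproduct U S) :
    [ P.obj.IsSimple,
      ∃ n : ℕ, 1 ≤ n ∧ P.obj.HasC n,
      ∃ n : ℕ, ∃ F ∈ U, ∀ j ∈ F, (S j).HasC n ].TFAE := by
  rcases eventually_scale_eq_empty_or_nonempty U S with h | h
  · have hP := P.scale_eq_empty h
    have h₁ := isSimple_of_scale_eq_empty hP
    have h₂ : ∃ n : ℕ, 1 ≤ n ∧ P.obj.HasC n := ⟨1, le_rfl, hasC_of_scale_eq_empty hP 1⟩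
    have h₃ : ∃ n : ℕ, ∃ F ∈ U, ∀ j ∈ F, (S j).HasC n :=
      ⟨0, _, h, fun j hj => hasC_of_scale_eq_empty hj 0⟩
    tfae_have 1 ↔ 2 := iff_of_true h₁ h₂
    tfae_have 2 ↔ 3 := iff_of_true h₂ h₃
    tfae_finish
  · let e := P.isoReducedProduct h
    tfae_have 1 → 3 := fun hs =>
      let ⟨n, hn⟩ := exists_eventually_hasC hU h (hs.of_iso e)
      ⟨n, _, hn, fun _ hj => hj⟩
    tfae_have 3 → 2 := fun ⟨n, F, hF, hn⟩ =>
      -- Passing to `n + 1` covers the case `n = 0`.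
      ⟨n + 1, Nat.le_add_left _ _, HasC.mono (Nat.le_succ n) (HasC.of_iso e.symm
        (hasC_of_eventually h (Filter.mem_of_superset hF hn)))⟩
    tfae_have 2 → 1 := fun ⟨n, _, hn⟩ =>
      IsSimple.of_iso e.symm (HasC.isSimple (hn.of_iso e) (exists_mem_scale hS))
    tfae_finish

end Cuntz

theorem mainTheorem8 {J : Type v} (U : Ultrafilter J)
    (hinc : ¬ CountableInterFilter (U : Filter J))
    (hfree : (U : Filter J) ≤ Filter.cofinite) :
    (∀ S : J → Cuntz.ScaledCu.{max u v}, (∀ j, (S j).SatisfiesO6) →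
      Nonempty (Cuntz.CatUltraproduct U S) ∧
      ∀ P : Cuntz.CatUltraproduct U S,
        [ P.obj.IsSimple,
          ∃ n : ℕ, 1 ≤ n ∧ P.obj.HasC n,
          ∃ n : ℕ, ∃ F ∈ U, ∀ j ∈ F, (S j).HasC n ].TFAE) ∧
    (∀ T : Cuntz.ScaledCu.{max u v}, T.SatisfiesO6 →
      ∀ P : Cuntz.CatUltraproduct U (fun _ : J => T),
        P.obj.IsSimple ↔ ∃ n : ℕ, T.HasC n) := by
  refine ⟨fun S hS => ⟨Cuntz.nonempty_catUltraproduct U S, fun P => P.isSimple_tfae hinc hS⟩,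
    fun T hT P => ?_⟩
  refine ((P.isSimple_tfae hinc fun _ => hT).out 0 2 rfl rfl).trans ?_
  refine exists_congr fun n => ⟨fun ⟨F, hF, h⟩ => ?_, fun h => ⟨_, Filter.univ_mem, fun _ _ => h⟩⟩
  obtain ⟨j, hj⟩ := U.nonempty_of_mem hF
  exact h j hj
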